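/- **Theorem (Correctness of top-sort).** *Host graphs.* A host graph is a finite directed graph, possibly with loops and parallel edges. Every node and edge carries a label (a finite list of integers and character strings; the empty list $\epsilon$ means "unlabelled") and a mark: nodes are unmarked, red, green, blue or grey; edges are unmarked, red, green, blue or dashed. In addition some nodes are distinguished as roots. Node names are taken from an infinite set, so that new nodes can always be created; edges are considered up to renaming, so that parallel edges matter only through their multiplicity. An *input graph* is a host graph $G$ with arbitrary labels such that any two nodes are joined by an undirected path (the empty graph is allowed), every node is grey and not a root, and every edge is unmarked. *Rules.* A rule $L\Rightarrow R$ consists of two graphs whose labels are list variables or constant lists. It is applied to $G$ by replacing the variables by lists, matching $L$ injectively into $G$ such that labels, marks and edges agree and such that roots are matched by roots and non-roots by non-roots, and then replacing the match by $R$: nodes occurring in both $L$ and $R$ stay in place (with changed label, mark and rootedness as prescribed by $R$), nodes only in $L$ are deleted (only allowed if no edge outside the match is incident with them), nodes only in $R$ are created, the matched edges are deleted and the edges of $R$ are inserted. Below, $i{:}x^{m}$ is node $i$ with label $x$ and mark $m$ ($m=\mathrm{any}$ is bound to an arbitrary mark, the same in $L$ and $R$; $m=-$ is "unmarked"), an asterisk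 marks roots, $i\xrightarrow{a,m}j$ is an edge with label $a$ and mark $m$, and $i\overset{a,m}{\text{—}}j$ is an edge that may be matched in either direction and keeps its direction. Edges without a displayed label are unlabelled; $a,b,x,y,z$ are list variables; $0$ is the list consisting of the integer $0$. A side that lists only its edges has the nodes stated for the other side. *Commands.* A rule-set call $\{r_1,\dots,r_n\}$ nondeterministically applies an applicable rule, and fails if there is none; $P;Q$ is sequential composition; "if $C$ then $P$ else $Q$" executes $C$ on a copy of the current graph $G$ and then executes $P$ on $G$ if $C$ resulted in a graph, and $Q$ on $G$ if $C$ failed; "try $C$ then $P$ else $Q$" does the same, except that $P$ is executed on the result of $C$; missing branches do nothing. The loop $P!$ executes $P$ repeatedly until it fails, and then terminates with the graph on which $P$ was entered last; "break" terminates the innermost enclosing loop with the current graph; "fail" fails. For a program $P$ and a host graph $G$, $[\![P]\!]G$ is the set of all outcomes of executing $P$ on $G$ according to the small-step semantics of GP 2: result graphs, $\mathrm{fail}$, and $\bot$ if the execution can diverge or get stuck. (In this semantics, the conditions of if and try and the bodies of loops are executed to completion within a single step.) *The program* $\mathrm{top\text{-}sort}$ is the command sequence Main: - Main = try init then (StackNodes!;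 unroot; LoopNodes!; if flag then fail) - StackNodes = {forward1, forward2}!; try back else break - LoopNodes = if flag then break; try skip1 else (try skip2 else (try init1 then (SortNodes!) else (try init2 then (SortNodes!) else break))) - SortNodes = forward!; if {loop, two_cycle, back_edge} then (set_flag; break); try back_push else (try back_first_push else ((try grey_push else grey_first_push); break)) with the rules - flag: $1{:}x^{-*}\Rightarrow 1{:}x^{-*}$ - init: $1{:}x^{grey}\Rightarrow 1{:}x^{red*},\,2{:}\epsilon^{green*},\,2\xrightarrow{red}1$ - forward1: $1{:}x^{red*},2{:}y^{grey},3{:}\epsilon^{green*},\,1\overset{a,-}{\text{—}}2,\,3\xrightarrow{red}1\ \Rightarrow\ 1{:}x^{red},2{:}y^{red*},3{:}\epsilon^{green*},\,1\overset{a,dashed}{\text{—}}2,\,3\xrightarrow{red}2,\,2\xrightarrow{red}1$ - forward2: $1{:}x^{red*},2{:}y^{grey},3{:}z^{red},4{:}\epsilon^{green*},\,1\overset{a,-}{\text{—}}2,\,4\xrightarrow{red}3\ \Rightarrow\ 1{:}x^{red},2{:}y^{red*},3{:}z^{red},4{:}\epsilon^{green*},\,1\overset{a,dashed}{\text{—}}2,\,2\xrightarrow{red}3,\,4\xrightarrow{red}2$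 - back: $1{:}x^{red},2{:}y^{red*},\,1\overset{a,dashed}{\text{—}}2\ \Rightarrow\ 1{:}x^{red*},2{:}y^{red},\,1\overset{a,-}{\text{—}}2$ - unroot: $1{:}x^{red*}\Rightarrow 1{:}x^{red}$ - skip1: $1{:}x^{blue},2{:}y^{any},3{:}z^{green*},\,1\xrightarrow{red}2,\,3\xrightarrow{red}1\ \Rightarrow\ 3\xrightarrow{red}2$ (same nodes) - skip2: $1{:}x^{blue},2{:}y^{green*},\,2\xrightarrow{red}1\ \Rightarrow\ $ the same nodes, no edge - init1: $1{:}x^{red},2{:}y^{any},3{:}z^{green*},\,1\xrightarrow{red}2,\,3\xrightarrow{red}1\ \Rightarrow\ 1{:}x^{grey*},2{:}y^{any},3{:}z^{green*},\,3\xrightarrow{red}2$ - init2: $1{:}x^{red},2{:}y^{green*},\,2\xrightarrow{red}1\ \Rightarrow\ 1{:}x^{grey*},2{:}y^{green*}$ - forward: $1{:}x^{grey*},2{:}y^{red},\,1\xrightarrow{a,-}2\ \Rightarrow\ 1{:}x^{grey},2{:}y^{grey*},\,1\xrightarrow{a,dashed}2$ - loop: $1{:}x^{grey*},\,1\xrightarrow{a,-}1$,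 unchanged - two_cycle: $1{:}x^{grey},2{:}y^{grey*},\,1\xrightarrow{a,dashed}2,\,2\xrightarrow{b,-}1$, unchanged - back_edge: $1{:}x^{grey},2{:}y^{grey*},3{:}z^{grey},\,2\xrightarrow{a,-}3,\,3\xrightarrow{b,dashed}1$, unchanged - set_flag: $1{:}x^{grey*}\Rightarrow 1{:}x^{-*}$ - grey_first_push: $1{:}\epsilon^{green*},2{:}x^{grey*}\ \Rightarrow\ 1{:}0^{green*},2{:}x^{blue},\,1\xrightarrow{blue}2$ - grey_push: $1{:}x^{grey*},2{:}y^{blue},3{:}0^{green*},\,3\xrightarrow{blue}2\ \Rightarrow\ 1{:}x^{blue},2{:}y^{blue},3{:}0^{green*},\,3\xrightarrow{blue}1,\,1\xrightarrow{blue}2$ - back_first_push: $1{:}x^{grey},2{:}y^{grey*},3{:}\epsilon^{green*},\,1\xrightarrow{a,dashed}2\ \Rightarrow\ 1{:}x^{grey*},2{:}y^{blue},3{:}0^{green*},\,1\xrightarrow{a,-}2,\,3\xrightarrow{blue}2$ - back_push: $1{:}x^{grey},2{:}y^{grey*},3{:}0^{green*},4{:}z^{blue},\,1\xrightarrow{a,dashed}2,\,3\xrightarrow{blue}4\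 \Rightarrow\ 1{:}x^{grey*},2{:}y^{blue},3{:}0^{green*},4{:}z^{blue},\,1\xrightarrow{a,-}2,\,3\xrightarrow{blue}2,\,2\xrightarrow{blue}4$ *Claim.* Let $G$ be an input graph. Then: 1. Execution of top-sort on $G$ always terminates: $\bot\notin[\![\mathrm{top\text{-}sort}]\!]G$. 2. If $G$ is not a DAG (it contains a directed cycle, possibly a loop), then top-sort fails: $[\![\mathrm{top\text{-}sort}]\!]G=\{\mathrm{fail}\}$. 3. If $G$ is a DAG, then $[\![\mathrm{top\text{-}sort}]\!]G$ is non-empty, and each of its elements is a host graph $H$ which is $G$ equipped with a topological sorting, in the following sense: - The transitive closure of the relation on the blue nodes of $H$ given by "$u=v$ or there is a blue edge from $u$ to $v$" is a topological sorting of the graph formed by the blue nodes and the unmarked edges of $H$ between them, that is, an antisymmetric, transitive and connex relation $\leq$ with $u\leq v$ for every unmarked edge from $u$ to $v$. - If $G$ is empty, then $H=G$. Otherwise $H$ arises from $G$ by marking all nodes blue, adding one new green root with label $0$ (the pointer), and adding unlabelled blue edges, which form a blue stack: the blue edges are exactly those of a path from the pointer that visits every node of $G$ exactly once, and the pointer is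 incident with no edge except the first edge of this path. -/

import Mathlib

namespace GP2

/-! ### Host graphs -/

/-- Atomic label values: integers and character strings. -/
inductive Atom where
  | int (n : ℤ)
  | str (s : String)
  deriving DecidableEq

/-- Values of labels: lists of atoms. The empty list means "unlabelled". -/
abbrev Label := List Atom

inductive NodeMark where
  | unmarked | red | green | blue | grey
  deriving DecidableEq

inductive EdgeMark where
  | unmarked | red | green | blue | dashed
  deriving DecidableEq

/-- The data carried by a node of a host graph. -/
structure NodeAttr where
  label : Label
  mark : NodeMark
  rooted : Bool
  deriving DecidableEq

/-- A directed edge between nodes from `N`, with its label and mark. -/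
structure Edge (N : Type*) where
  src : N
  tgt : N
  label : Label
  mark : EdgeMark

/-- A host graph: a finite directed graph with loops and parallel edges, whose nodes
are identified by elements of `N`. The value `node v` is `none` if `v` is not a node of the graph,
and otherwise the data of the node `v`. Parallel edges with equal labels and marks are counted
by the multiplicity in the multiset `edges`. -/
@[ext]
structure HostGraph (N : Type*) where
  node : N → Option NodeAttr
  edges : Multiset (Edge N)
  finite_nodes : {v | node v ≠ none}.Finite
  edge_mem : ∀ e ∈ edges, node e.src ≠ none ∧ node e.tgt ≠ none

/-! ### Rules -/

/-- List variables. -/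
inductive Var where
  | a | b | x | y | z
  deriving DecidableEq

/-- Label expressions: a list variable or a constant list. -/
inductive Expr where
  | var (v : Var)
  | const (l : Label)

/-- The mark of a node in a rule: a fixed mark, or magenta, which is bound to an arbitrary mark
when the rule is instantiated. -/
inductive RuleMark where
  | fixed (m : NodeMark)
  | magenta

/-- A node of a rule graph, with its identifier `id`. -/
structure RuleNode where
  id : ℕ
  label : Expr
  mark : RuleMark
  rooted : Bool

/-- An edge of a rule graph. A bidirectional edge (drawn without an arrow head) may be instantiated
in either direction. -/
structure RuleEdge where
  src : ℕ
  tgt : ℕ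
  label : Expr
  mark : EdgeMark
  bidirectional : Bool

structure RuleGraph where
  nodes : List RuleNode
  edges : List RuleEdge

def RuleGraph.ids (L : RuleGraph) : List ℕ := L.nodes.map RuleNode.id

/-- A rule `lhs ⇒ rhs`. Nodes whose identifier occurs on both sides stay in place, the other nodes
of `lhs` are deleted and the other nodes of `rhs` are created. -/
structure Rule where
  lhs : RuleGraph
  rhs : RuleGraph

/-- An instantiation of a rule together with an assignment of host graph nodes: `val` gives the
values of the variables, `mark i` the mark to which magenta is bound at the node `i`, `flip i j`
tells whether a bidirectional edge written from `i` to `j` is reversed (in the same way on both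
sides of the rule), and `node` maps the nodes of the rule to nodes of the host graph. -/
structure Instantiation (N : Type*) where
  val : Var → Label
  mark : ℕ → NodeMark
  flip : ℕ → ℕ → Bool
  node : ℕ → N

namespace Instantiation

variable {N : Type*}

def eval (ι : Instantiation N) : Expr → Label
  | .var v => ι.val v
  | .const l => l

def evalMark (ι : Instantiation N) (i : ℕ) : RuleMark → NodeMark
  | .fixed m => m
  | .magenta => ι.mark i

def attr (ι : Instantiation N) (n : RuleNode) : NodeAttr where
  label := ι.eval n.label
  mark := ι.evalMark n.id n.mark
  rooted := n.rooted

def edge (ι : Instantiation N) (e : RuleEdge) : Edge N :=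
  if e.bidirectional && ι.flip e.src e.tgt then
    ⟨ι.node e.tgt, ι.node e.src, ι.eval e.label, e.mark⟩
  else
    ⟨ι.node e.src, ι.node e.tgt, ι.eval e.label, e.mark⟩

end Instantiation

/-- `r.Applies ι G H`: the graph `H` results from `G` by applying the rule `r` with the
instantiation and (injective) match `ι`. Matched nodes agree with the nodes of the instantiated
left-hand side in label, mark and rootedness (rootedness is both preserved and reflected). The
multiset `M` consists of the edges of `G` outside the match. -/
structure Rule.Applies {N : Type*} (r : Rule) (ι : Instantiation N) (G H : HostGraph N) :
    Prop where
  inj : Set.InjOn ι.node {i | i ∈ r.lhs.ids ∨ i ∈ r.rhs.ids}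
  lhs_node : ∀ n ∈ r.lhs.nodes, G.node (ι.node n.id) = some (ι.attr n)
  fresh : ∀ i ∈ r.rhs.ids, i ∉ r.lhs.ids → G.node (ι.node i) = none
  edges : ∃ M : Multiset (Edge N),
    G.edges = M + Multiset.ofList (r.lhs.edges.map ι.edge) ∧
    H.edges = M + Multiset.ofList (r.rhs.edges.map ι.edge) ∧
    -- the dangling condition
    ∀ i ∈ r.lhs.ids, i ∉ r.rhs.ids → ∀ e ∈ M, e.src ≠ ι.node i ∧ e.tgt ≠ ι.node i
  rhs_node : ∀ n ∈ r.rhs.nodes, H.node (ι.node n.id) = some (ι.attr n)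
  deleted : ∀ i ∈ r.lhs.ids, i ∉ r.rhs.ids → H.node (ι.node i) = none
  unchanged : ∀ v, (∀ i, i ∈ r.lhs.ids ∨ i ∈ r.rhs.ids → ι.node i ≠ v) → H.node v = G.node v

/-- `Derives R G H`: the graph `H` results from `G` by applying a rule of the rule set `R`. -/
def Derives {N : Type*} (R : List Rule) (G H : HostGraph N) : Prop :=
  ∃ r ∈ R, ∃ ι : Instantiation N, r.Applies ι G H

/-! ### Programs and their operational semantics -/

inductive Command where
  | call (R : List Rule)
  | seq (P Q : Command)
  | ifte (C P Q : Command)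
  | ift (C P : Command)
  | tryte (C P Q : Command)
  | tryt (C P : Command)
  | trye (C Q : Command)
  | try1 (C : Command)
  | alap (P : Command)
  | or (P Q : Command)
  | skip
  | fail
  | break

/-- Configurations: a rest program with a host graph, a resulting host graph, or failure. -/
inductive Config (N : Type*) where
  | run (P : Command) (G : HostGraph N)
  | result (G : HostGraph N)
  | fail

/-- The transitive closure of a relation. It is equivalent to `Relation.TransGen`, but can occur in
the premises of an inductive definition of `r` itself. -/
inductive Plus {α : Type*} (r : α → α → Prop) : α → α → Prop where
  | single {a b} : r a b → Plus r a b
  | trans {a b c} : Plus r a b → Plus r b c → Plus r a c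

/-- The reflexive-transitive closure of a relation. It is equivalent to `Relation.ReflTransGen`, but
can occur in the premises of an inductive definition of `r` itself. -/
inductive Star {α : Type*} (r : α → α → Prop) : α → α → Prop where
  | refl {a} : Star r a a
  | single {a b} : r a b → Star r a b
  | trans {a b c} : Star r a b → Star r b c → Star r a c

theorem plus_iff_transGen {α : Type*} {r : α → α → Prop} {a b : α} :
    Plus r a b ↔ Relation.TransGen r a b := by
  constructor
  · intro h
    induction h with
    | single h => exact .single h
    | trans _ _ ih1 ih2 => exact .trans ih1 ih2
  · intro h
    induction h with
    | single h => exact .single h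
    | tail _ h ih => exact .trans ih (.single h)

theorem star_iff_reflTransGen {α : Type*} {r : α → α → Prop} {a b : α} :
    Star r a b ↔ Relation.ReflTransGen r a b := by
  constructor
  · intro h
    induction h with
    | refl => exact .refl
    | single h => exact .single h
    | trans _ _ ih1 ih2 => exact .trans ih1 ih2
  · intro h
    induction h with
    | refl => exact .refl
    | tail _ h ih => exact .trans ih (.single h)

/-- The small-step transition relation of GP 2. -/
inductive Step {N : Type*} : Config N → Config N → Prop where
  | call1 {R G H} : Derives R G H → Step (.run (.call R) G) (.result H)
  | call2 {R G} : (¬ ∃ H, Derives R G H) → Step (.run (.call R) G) .fail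
  | seq1 {P P' Q G H} : Step (.run P G) (.run P' H) →
      Step (.run (.seq P Q) G) (.run (.seq P' Q) H)
  | seq2 {P Q G H} : Step (.run P G) (.result H) → Step (.run (.seq P Q) G) (.run Q H)
  | seq3 {P Q G} : Step (.run P G) .fail → Step (.run (.seq P Q) G) .fail
  | if1 {C P Q G H} : Plus Step (.run C G) (.result H) →
      Step (.run (.ifte C P Q) G) (.run P G)
  | if2 {C P Q G} : Plus Step (.run C G) .fail → Step (.run (.ifte C P Q) G) (.run Q G)
  | try1 {C P Q G H} : Plus Step (.run C G) (.result H) →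
      Step (.run (.tryte C P Q) G) (.run P H)
  | try2 {C P Q G} : Plus Step (.run C G) .fail → Step (.run (.tryte C P Q) G) (.run Q G)
  | alap1 {P G H} : Plus Step (.run P G) (.result H) →
      Step (.run (.alap P) G) (.run (.alap P) H)
  | alap2 {P G} : Plus Step (.run P G) .fail → Step (.run (.alap P) G) (.result G)
  | alap3 {P G H} : Star Step (.run P G) (.run .break H) →
      Step (.run (.alap P) G) (.result H)
  | break {P G} : Step (.run (.seq .break P) G) (.run .break G)
  | or1 {P Q G} : Step (.run (.or P Q) G) (.run P G)
  | or2 {P Q G} : Step (.run (.or P Q) G) (.run Q G)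
  | skip {G} : Step (.run .skip G) (.result G)
  | fail {G} : Step (.run .fail G) .fail
  | if3 {C P G} : Step (.run (.ift C P) G) (.run (.ifte C P .skip) G)
  | try3 {C P G} : Step (.run (.tryt C P) G) (.run (.tryte C P .skip) G)
  | try4 {C P G} : Step (.run (.trye C P) G) (.run (.tryte C .skip P) G)
  | try5 {C G} : Step (.run (.try1 C) G) (.run (.tryte C .skip .skip) G)

/-- `P` can diverge from `G`: there is an infinite sequence of steps. -/
def CanDiverge {N : Type*} (P : Command) (G : HostGraph N) : Prop :=
  ∃ c : ℕ → Config N, c 0 = .run P G ∧ ∀ n, Step (c n) (c (n + 1))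

/-- `P` can get stuck from `G`: a terminal configuration with a rest program is reachable. -/
def CanGetStuck {N : Type*} (P : Command) (G : HostGraph N) : Prop :=
  ∃ Q H, Relation.ReflTransGen Step (Config.run P G) (Config.run Q H) ∧
    ∀ c, ¬ Step (Config.run Q H) c

/-- Outcomes of a program run: a host graph, failure, or `bot` (divergence or getting stuck). -/
inductive Outcome (N : Type*) where
  | graph (G : HostGraph N)
  | fail
  | bot

/-- The semantic function: the set of all outcomes of executing `P` on `G`. -/
def sem {N : Type*} (P : Command) (G : HostGraph N) : Set (Outcome N)
  | .graph H => Relation.TransGen Step (Config.run P G) (Config.result H)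
  | .fail => Relation.TransGen Step (Config.run P G) Config.fail
  | .bot => CanDiverge P G ∨ CanGetStuck P G

/-! ### The program `top-sort` -/

namespace TopSort

/-- An unrooted node with a fixed mark, labelled by a variable. -/
def node (i : ℕ) (v : Var) (m : NodeMark) : RuleNode := ⟨i, .var v, .fixed m, false⟩

/-- A root with a fixed mark, labelled by a variable. -/
def root (i : ℕ) (v : Var) (m : NodeMark) : RuleNode := ⟨i, .var v, .fixed m, true⟩

/-- An unrooted magenta node, labelled by a variable. -/
def anyNode (i : ℕ) (v : Var) : RuleNode := ⟨i, .var v, .magenta, false⟩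

/-- A green root with a constant label. -/
def pointer (i : ℕ) (l : Label) : RuleNode := ⟨i, .const l, .fixed .green, true⟩

/-- The list consisting of the integer 0. -/
def zero : Label := [.int 0]

/-- A directed edge labelled by a variable. -/
def arrow (i j : ℕ) (v : Var) (m : EdgeMark) : RuleEdge := ⟨i, j, .var v, m, false⟩

/-- A bidirectional edge labelled by a variable. -/
def link (i j : ℕ) (v : Var) (m : EdgeMark) : RuleEdge := ⟨i, j, .var v, m, true⟩

/-- A directed red edge labelled by the empty list. -/
def redEdge (i j : ℕ) : RuleEdge := ⟨i, j, .const [], .red, false⟩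

/-- A directed blue edge labelled by the empty list. -/
def blueEdge (i j : ℕ) : RuleEdge := ⟨i, j, .const [], .blue, false⟩

def flag : Rule where
  lhs := ⟨[root 1 .x .unmarked], []⟩
  rhs := ⟨[root 1 .x .unmarked], []⟩

def init : Rule where
  lhs := ⟨[node 1 .x .grey], []⟩
  rhs := ⟨[root 1 .x .red, pointer 2 []], [redEdge 2 1]⟩

def forward1 : Rule where
  lhs := ⟨[root 1 .x .red, node 2 .y .grey, pointer 3 []],
    [link 1 2 .a .unmarked, redEdge 3 1]⟩
  rhs := ⟨[node 1 .x .red, root 2 .y .red, pointer 3 []],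
    [link 1 2 .a .dashed, redEdge 3 2, redEdge 2 1]⟩

def forward2 : Rule where
  lhs := ⟨[root 1 .x .red, node 2 .y .grey, node 3 .z .red, pointer 4 []],
    [link 1 2 .a .unmarked, redEdge 4 3]⟩
  rhs := ⟨[node 1 .x .red, root 2 .y .red, node 3 .z .red, pointer 4 []],
    [link 1 2 .a .dashed, redEdge 2 3, redEdge 4 2]⟩

def back : Rule where
  lhs := ⟨[node 1 .x .red, root 2 .y .red], [link 1 2 .a .dashed]⟩
  rhs := ⟨[root 1 .x .red, node 2 .y .red], [link 1 2 .a .unmarked]⟩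

def unroot : Rule where
  lhs := ⟨[root 1 .x .red], []⟩
  rhs := ⟨[node 1 .x .red], []⟩

def skip1 : Rule where
  lhs := ⟨[node 1 .x .blue, anyNode 2 .y, root 3 .z .green], [redEdge 1 2, redEdge 3 1]⟩
  rhs := ⟨[node 1 .x .blue, anyNode 2 .y, root 3 .z .green], [redEdge 3 2]⟩

def skip2 : Rule where
  lhs := ⟨[node 1 .x .blue, root 2 .y .green], [redEdge 2 1]⟩
  rhs := ⟨[node 1 .x .blue, root 2 .y .green], []⟩

def init1 : Rule where
  lhs := ⟨[node 1 .x .red, anyNode 2 .y, root 3 .z .green], [redEdge 1 2, redEdge 3 1]⟩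
  rhs := ⟨[root 1 .x .grey, anyNode 2 .y, root 3 .z .green], [redEdge 3 2]⟩

def init2 : Rule where
  lhs := ⟨[node 1 .x .red, root 2 .y .green], [redEdge 2 1]⟩
  rhs := ⟨[root 1 .x .grey, root 2 .y .green], []⟩

def forward : Rule where
  lhs := ⟨[root 1 .x .grey, node 2 .y .red], [arrow 1 2 .a .unmarked]⟩
  rhs := ⟨[node 1 .x .grey, root 2 .y .grey], [arrow 1 2 .a .dashed]⟩

def loop : Rule where
  lhs := ⟨[root 1 .x .grey], [arrow 1 1 .a .unmarked]⟩
  rhs := ⟨[root 1 .x .grey], [arrow 1 1 .a .unmarked]⟩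

def setFlag : Rule where
  lhs := ⟨[root 1 .x .grey], []⟩
  rhs := ⟨[root 1 .x .unmarked], []⟩

def twoCycle : Rule where
  lhs := ⟨[node 1 .x .grey, root 2 .y .grey], [arrow 1 2 .a .dashed, arrow 2 1 .b .unmarked]⟩
  rhs := ⟨[node 1 .x .grey, root 2 .y .grey], [arrow 1 2 .a .dashed, arrow 2 1 .b .unmarked]⟩

def backEdge : Rule where
  lhs := ⟨[node 1 .x .grey, root 2 .y .grey, node 3 .z .grey],
    [arrow 2 3 .a .unmarked, arrow 3 1 .b .dashed]⟩
  rhs := ⟨[node 1 .x .grey, root 2 .y .grey, node 3 .z .grey],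
    [arrow 2 3 .a .unmarked, arrow 3 1 .b .dashed]⟩

def greyFirstPush : Rule where
  lhs := ⟨[pointer 1 [], root 2 .x .grey], []⟩
  rhs := ⟨[pointer 1 zero, node 2 .x .blue], [blueEdge 1 2]⟩

def greyPush : Rule where
  lhs := ⟨[root 1 .x .grey, node 2 .y .blue, pointer 3 zero], [blueEdge 3 2]⟩
  rhs := ⟨[node 1 .x .blue, node 2 .y .blue, pointer 3 zero], [blueEdge 3 1, blueEdge 1 2]⟩

def backFirstPush : Rule where
  lhs := ⟨[node 1 .x .grey, root 2 .y .grey, pointer 3 []], [arrow 1 2 .a .dashed]⟩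
  rhs := ⟨[root 1 .x .grey, node 2 .y .blue, pointer 3 zero],
    [arrow 1 2 .a .unmarked, blueEdge 3 2]⟩

def backPush : Rule where
  lhs := ⟨[node 1 .x .grey, root 2 .y .grey, pointer 3 zero, node 4 .z .blue],
    [arrow 1 2 .a .dashed, blueEdge 3 4]⟩
  rhs := ⟨[root 1 .x .grey, node 2 .y .blue, pointer 3 zero, node 4 .z .blue],
    [arrow 1 2 .a .unmarked, blueEdge 3 2, blueEdge 2 4]⟩

open Command

/-- `{forward1, forward2}!; try back else break` -/
def stackNodes : Command :=
  seq (alap (call [forward1, forward2])) (trye (call [back]) .break)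

/-- `forward!; if {loop, two_cycle, back_edge} then (set_flag; break);`
`try back_push else (try back_first_push else (try grey_push else (grey_first_push); break))` -/
def sortNodes : Command :=
  seq (alap (call [forward]))
    (seq (ift (call [loop, twoCycle, backEdge]) (seq (call [setFlag]) .break))
      (trye (call [backPush])
        (trye (call [backFirstPush])
          (seq (trye (call [greyPush]) (call [greyFirstPush])) .break))))

/-- `if flag then break; try skip1 else (try skip2 else (try init1 then (SortNodes!)`
`else (try init2 then (SortNodes!) else (break))))` -/
def loopNodes : Command :=
  seq (ift (call [flag]) .break)
    (trye (call [skip1])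
      (trye (call [skip2])
        (tryte (call [init1]) (alap sortNodes)
          (tryte (call [init2]) (alap sortNodes) .break))))

/-- `try init then (StackNodes!; unroot; LoopNodes!; if flag then fail)` -/
def main : Command :=
  tryt (call [init])
    (seq (alap stackNodes)
      (seq (call [unroot])
        (seq (alap loopNodes)
          (ift (call [flag]) .fail))))

end TopSort

/-! ### Input graphs and topological sortings -/

namespace HostGraph

variable {N : Type*}

/-- There is an edge from `u` to `v`. -/
def Arc (G : HostGraph N) (u v : N) : Prop := ∃ e ∈ G.edges, e.src = u ∧ e.tgt = v

/-- Any two nodes are joined by an undirected path. The empty graph is connected. -/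
def IsConnected (G : HostGraph N) : Prop :=
  ∀ u v, G.node u ≠ none → G.node v ≠ none →
    Relation.ReflTransGen (fun s t => G.Arc s t ∨ G.Arc t s) u v

/-- Input graphs: arbitrarily labelled, connected, all nodes grey and unrooted, all edges
unmarked. -/
structure IsInput (G : HostGraph N) : Prop where
  connected : G.IsConnected
  grey : ∀ v a, G.node v = some a → a.mark = .grey
  unrooted : ∀ v a, G.node v = some a → a.rooted = false
  unmarked : ∀ e ∈ G.edges, e.mark = .unmarked

/-- No directed cycle (in particular no loop): no node reaches itself along a directed path with at
least one edge. -/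
def IsDAG (G : HostGraph N) : Prop := ∀ v, ¬ Relation.TransGen G.Arc v v

/-- The node `v` belongs to the graph and is marked blue. -/
def IsBlue (G : HostGraph N) (v : N) : Prop := ∃ a, G.node v = some a ∧ a.mark = .blue

/-- The relation on the blue nodes given by blue edges and equality. -/
def blueRel (G : HostGraph N) (u v : {v // G.IsBlue v}) : Prop :=
  (∃ e ∈ G.edges, e.mark = .blue ∧ e.src = u ∧ e.tgt = v) ∨ u = v

end HostGraph

/-- The relation `le` is a topological sorting of the graph with node set `V` and an edge from `u`
to `v` whenever `arc u v`: a total order (antisymmetric, transitive and connex) which contains all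
the edges. -/
structure IsTopologicalSorting {V : Type*} (arc le : V → V → Prop) : Prop where
  antisymm : ∀ u v, le u v → le v u → u = v
  trans : ∀ u v w, le u v → le v w → le u w
  connex : ∀ u v, le u v ∨ le v u
  topological : ∀ u v, arc u v → le u v

namespace HostGraph

variable {N : Type*}

/-- The transitive closure of `blueRel` is a topological sorting of the subgraph induced by the blue
nodes and the unmarked edges. -/
def ContainsTopologicalSorting (G : HostGraph N) : Prop :=
  IsTopologicalSorting
    (fun u v : {v // G.IsBlue v} => ∃ e ∈ G.edges, e.mark = .unmarked ∧ e.src = u ∧ e.tgt = v)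
    (Relation.TransGen G.blueRel)

end HostGraph

/-- The unlabelled blue edges of the path that starts in `u` and continues along the list. -/
def bluePath {N : Type*} : N → List N → Multiset (Edge N)
  | _, [] => 0
  | u, v :: l => ⟨u, v, [], .blue⟩ ::ₘ bluePath v l

/-- The blue nodes and blue edges of `G` form a blue stack with pointer `p`, whose nodes, from the
top to the bottom, are `l`: the blue nodes are listed without repetition in `l`, the pointer is a
green root outside the stack, the blue edges are those of the path from `p` along `l`, and the
pointer has no other incident edges. -/
structure IsBlueStack {N : Type*} (G : HostGraph N) (p : N) (l : List N) : Prop where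
  ne_nil : l ≠ []
  nodup : l.Nodup
  mem_iff : ∀ v, v ∈ l ↔ G.IsBlue v
  pointer : ∃ a, G.node p = some a ∧ a.mark = .green ∧ a.rooted = true
  blue_edges : G.edges.filter (fun e => e.mark = .blue) = bluePath p l
  pointer_edges : ∀ e ∈ G.edges, e.src = p ∨ e.tgt = p → e.mark = .blue

/-- `H` is `G` with its nodes marked blue and arranged in a blue stack, by means of a new pointer
node `p` (labelled 0) and the new edges of the stack. -/
def IsStacked {N : Type*} (G H : HostGraph N) : Prop :=
  ∃ (p : N) (l : List N),
    G.node p = none ∧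
    H.node p = some ⟨TopSort.zero, .green, true⟩ ∧
    (∀ v, v ≠ p → H.node v = (G.node v).map (fun a => { a with mark := .blue })) ∧
    H.edges = G.edges + bluePath p l ∧
    IsBlueStack H p l

/-- `H` is `G` equipped with a topological sorting, encoded as a blue stack. The empty graph is left
as it is. -/
structure IsEquippedWithSorting {N : Type*} (G H : HostGraph N) : Prop where
  sorting : H.ContainsTopologicalSorting
  empty : (∀ v, G.node v = none) → H = G
  nonempty : (∃ v, G.node v ≠ none) → IsStacked G H

end GP2

/-! The proof is a total-correctness argument: an invariant for every loop and a natural number that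
decreases with every iteration. `Spec` states that all executions of a command end properly and what
the outcomes satisfy; its main rules are `Spec.seq` and `Spec.alap`. Since every condition of `if`
and `try` in the program is a single rule-set call, it is enough to know for each rule when it
applies (lemmas `exists_...`) and what it does (lemmas `derives_...`).

All invariants rest on `Shape`: up to colours and the root, an intermediate graph is the input graph
with some edges dashed, plus a pointer from which a red and a blue path start. These paths are the
two stacks, and the dashed edges form the current search path.

The first phase is an undirected depth-first search whose visited nodes form the red stack. Its
invariant (`StackState`) says that a visited node off the search path has only visited neighbours.
When the search is stuck at its starting node, the red stack is closed under adjacency, so it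
contains every node by connectedness (`StackState.mem_red`).

The second phase pops the red stack and runs a directed search from each node that is not yet blue.
A node becomes blue only when all its successors are blue (`SortState.closed`), so every arc that
starts in the blue stack leads strictly further down (`SortedList`). The flag is raised only if the
root has an arc to a node of the search path; that path consists of arcs directed towards the root,
so there is a directed cycle (`SortState.not_isDAG`).

Hence failure certifies a cycle. A result graph for a nonempty input has an empty red stack, so all
nodes of the input are blue; the sorted blue stack then certifies both acyclicity
(`LoopState.isDAG`) and the topological order. As some outcome exists and none is `bot`, these two
certificates decide the outcome, and completeness of the cycle detection needs no separate argument.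
-/

namespace GP2

variable {N : Type*}

/-! ### Total correctness -/

/-- Every execution from the given configuration terminates, in a configuration that satisfies
`Post` and admits no further step. -/
inductive Always (Post : Config N → Prop) : Config N → Prop where
  | done {c} : Post c → (∀ d, ¬ Step c d) → Always Post c
  | step {c} : (∃ d, Step c d) → (∀ d, Step c d → Always Post d) → Always Post c

theorem not_step_result {G : HostGraph N} {c : Config N} : ¬ Step (.result G) c := nofun

theorem not_step_fail {c : Config N} : ¬ Step .fail c := nofun

theorem not_step_break {G : HostGraph N} {c : Config N} : ¬ Step (.run .break G) c := nofun

namespace Always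

variable {Post Post' : Config N → Prop} {c d : Config N}

theorem post (h : Always Post c) (hc : ∀ d, ¬ Step c d) : Post c := by
  cases h with
  | done h _ => exact h
  | step h _ => exact absurd h.choose_spec (hc _)

theorem reach (h : Always Post c) (hd : Relation.ReflTransGen Step c d) : Always Post d := by
  induction hd with
  | refl => exact h
  | tail _ hs ih =>
    cases ih with
    | done _ h => exact absurd hs (h _)
    | step _ h => exact h _ hs

theorem exists_post (h : Always Post c) :
    ∃ d, Relation.ReflTransGen Step c d ∧ Post d ∧ ∀ e, ¬ Step d e := by
  induction h with
  | done h hc => exact ⟨_, .refl, h, hc⟩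
  | step h _ ih =>
    obtain ⟨d, hd⟩ := h
    obtain ⟨e, he, hp⟩ := ih d hd
    exact ⟨e, .head hd he, hp⟩

theorem acc (h : Always Post c) : Acc (fun d c => Step c d) c := by
  induction h with
  | done _ hc => exact ⟨_, fun d hd => absurd hd (hc d)⟩
  | step _ _ ih => exact ⟨_, ih⟩

end Always

/-- The postcondition given by predicates for result graphs and for graphs on which a surrounding
loop is left, and by a condition for failure. -/
def Post (R B : HostGraph N → Prop) (F : Prop) : Config N → Prop
  | .result H => R H
  | .run .break H => B H
  | .fail => F
  | _ => False

/-- Every execution of `P` on `G` terminates with a graph that satisfies `R`, with a `break` on a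
graph that satisfies `B`, or with failure; the latter only if `F` holds. -/
def Spec (P : Command) (G : HostGraph N) (R B : HostGraph N → Prop) (F : Prop) : Prop :=
  Always (Post R B F) (.run P G)

theorem Post.run_eq {R B : HostGraph N → Prop} {F : Prop} {P : Command} {G : HostGraph N}
    (h : Post R B F (.run P G)) : P = .break ∧ B G := by
  cases P <;> first | exact h.elim | exact ⟨rfl, h⟩

namespace Spec

variable {P Q C : Command} {S : List Rule} {G : HostGraph N} {R R' B : HostGraph N → Prop}
  {F : Prop}

theorem always_result (h : R G) : Always (Post R B F) (.result G) :=
  .done h fun _ => not_step_result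

theorem always_fail (h : F) : Always (Post R B F) .fail :=
  .done h fun _ => not_step_fail

theorem result_of_reach {H : HostGraph N} (h : Spec P G R B F)
    (hH : Relation.ReflTransGen Step (.run P G) (.result H)) : R H :=
  (Always.reach h hH).post fun _ => not_step_result

theorem break_of_reach {H : HostGraph N} (h : Spec P G R B F)
    (hH : Relation.ReflTransGen Step (.run P G) (.run .break H)) : B H :=
  (Always.reach h hH).post fun _ => not_step_break

theorem fail_of_reach (h : Spec P G R B F)
    (hH : Relation.ReflTransGen Step (.run P G) .fail) : F :=
  (Always.reach h hH).post fun _ => not_step_fail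

theorem brk (h : B G) : Spec .break G R B F := .done h fun _ => not_step_break

theorem skip (h : R G) : Spec .skip G R B F :=
  .step ⟨_, .skip⟩ fun _ hd => by cases hd; exact always_result h

theorem fail (h : F) : Spec .fail G R B F :=
  .step ⟨_, .fail⟩ fun _ hd => by cases hd; exact always_fail h

theorem call (h : ∀ H, Derives S G H → R H) (h' : (¬ ∃ H, Derives S G H) → F) :
    Spec (.call S) G R B F := by
  refine .step ?_ fun d hd => ?_
  · by_cases hS : ∃ H, Derives S G H
    · exact ⟨_, .call1 hS.choose_spec⟩
    · exact ⟨_, .call2 hS⟩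
  · cases hd with
    | call1 hd => exact always_result (h _ hd)
    | call2 hd => exact always_fail (h' hd)

/-- The induction needs an arbitrary configuration, whence the detour through `c = .run P G`. A
terminal `P` can only be `break`, and `Step.break` then discards `Q`. -/
theorem seq_of_always {c : Config N} (h : Always (Post R' B F) c)
    (hQ : ∀ H, R' H → Spec Q H R B F) : ∀ P G, c = .run P G → Spec (.seq P Q) G R B F := by
  induction h with
  | done h _ =>
    rintro P G rfl
    obtain ⟨rfl, hB⟩ := h.run_eq
    refine .step ⟨_, .break⟩ fun d hd => ?_
    cases hd with
    | seq1 hd => cases hd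
    | seq2 hd => cases hd
    | seq3 hd => cases hd
    | _ => exact brk hB
  | step h h' ih =>
    rintro P G rfl
    refine .step ?_ fun d hd => ?_
    · obtain ⟨d, hd⟩ := h
      cases d with
      | run P' H => exact ⟨_, .seq1 hd⟩
      | result H => exact ⟨_, .seq2 hd⟩
      | fail => exact ⟨_, .seq3 hd⟩
    · cases hd with
      | seq1 hd => exact ih _ hd _ _ rfl
      | seq2 hd => exact hQ _ ((h' _ hd).post fun _ => not_step_result)
      | seq3 hd => exact always_fail ((h' _ hd).post fun _ => not_step_fail)
      | _ => exact absurd h.choose_spec not_step_break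

theorem seq (h : Spec P G R' B F) (hQ : ∀ H, R' H → Spec Q H R B F) :
    Spec (.seq P Q) G R B F :=
  seq_of_always h hQ _ _ rfl

/-- A call finishes in one step, so the `Plus` premises of `if` and `try` collapse to `Derives` when
the condition is a call. -/
theorem plus_call_result {H : HostGraph N} :
    Plus Step (.run (.call S) G) (.result H) ↔ Derives S G H := by
  refine ⟨fun h => ?_, fun h => .single (.call1 h)⟩
  exact result_of_reach (R := Derives S G) (B := fun _ => True) (F := True)
    (.call (fun _ h => h) fun _ => trivial) (plus_iff_transGen.1 h).to_reflTransGen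

theorem plus_call_fail :
    Plus Step (.run (.call S) G) .fail ↔ ¬ ∃ H, Derives S G H := by
  refine ⟨fun h => ?_, fun h => .single (.call2 h)⟩
  exact fail_of_reach (R := fun _ => True) (B := fun _ => True)
    (.call (fun _ _ => trivial) fun h => h) (plus_iff_transGen.1 h).to_reflTransGen

theorem ifte_call (hP : ∀ H, Derives S G H → Spec P G R B F)
    (hQ : (¬ ∃ H, Derives S G H) → Spec Q G R B F) : Spec (.ifte (.call S) P Q) G R B F := by
  refine .step ?_ fun d hd => ?_
  · by_cases hS : ∃ H, Derives S G H
    · exact ⟨_, .if1 (plus_call_result.2 hS.choose_spec)⟩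
    · exact ⟨_, .if2 (plus_call_fail.2 hS)⟩
  · cases hd with
    | if1 hd => exact hP _ (plus_call_result.1 hd)
    | if2 hd => exact hQ (plus_call_fail.1 hd)

theorem tryte_call (hP : ∀ H, Derives S G H → Spec P H R B F)
    (hQ : (¬ ∃ H, Derives S G H) → Spec Q G R B F) : Spec (.tryte (.call S) P Q) G R B F := by
  refine .step ?_ fun d hd => ?_
  · by_cases hS : ∃ H, Derives S G H
    · exact ⟨_, .try1 (plus_call_result.2 hS.choose_spec)⟩
    · exact ⟨_, .try2 (plus_call_fail.2 hS)⟩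
  · cases hd with
    | try1 hd => exact hP _ (plus_call_result.1 hd)
    | try2 hd => exact hQ (plus_call_fail.1 hd)

theorem ift_call (hP : ∀ H, Derives S G H → Spec P G R B F)
    (hQ : (¬ ∃ H, Derives S G H) → R G) : Spec (.ift (.call S) P) G R B F :=
  .step ⟨_, .if3⟩ fun _ hd => by cases hd; exact ifte_call hP fun h => .skip (hQ h)

theorem tryt_call (hP : ∀ H, Derives S G H → Spec P H R B F)
    (hQ : (¬ ∃ H, Derives S G H) → R G) : Spec (.tryt (.call S) P) G R B F :=
  .step ⟨_, .try3⟩ fun _ hd => by cases hd; exact tryte_call hP fun h => .skip (hQ h)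

theorem trye_call (hP : ∀ H, Derives S G H → R H)
    (hQ : (¬ ∃ H, Derives S G H) → Spec Q G R B F) : Spec (.trye (.call S) Q) G R B F :=
  .step ⟨_, .try4⟩ fun _ hd => by cases hd; exact tryte_call (fun H h => .skip (hP H h)) hQ

theorem mono {B' R' : HostGraph N → Prop} {F' : Prop} (h : Spec P G R B F)
    (hR : ∀ H, R H → R' H) (hB : ∀ H, B H → B' H) (hF : F → F') : Spec P G R' B' F' := by
  have key : ∀ c, Always (Post R B F) c → Always (Post R' B' F') c := by
    intro c hc
    induction hc with
    | @done c h hc =>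
      refine .done ?_ hc
      match c with
      | .result H => exact hR _ h
      | .fail => exact hF h
      | .run P H => obtain ⟨rfl, h⟩ := h.run_eq; exact hB _ h
    | step h _ ih => exact .step h ih
  exact key _ h

/-- Loops: each iteration of the body yields a result graph with a smaller variant, and the loop
ends when the body fails or breaks. -/
theorem alap (Inv : ℕ → HostGraph N → Prop)
    (h : ∀ n G, Inv n G → Spec P G (fun H => ∃ m < n, Inv m H) R (R G))
    (n : ℕ) : ∀ G, Inv n G → Spec (.alap P) G R B F := by
  induction n using Nat.strong_induction_on with
  | _ n ih =>
    intro G hG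
    have hP := h n G hG
    refine .step ?_ fun d hd => ?_
    -- Progress: some execution of the body runs to its end, and the form of its last configuration
    -- tells which loop rule fires.
    · obtain ⟨d, hd, hp, -⟩ := hP.exists_post
      match d with
      | .result H =>
        refine ⟨_, .alap1 (H := H) (plus_iff_transGen.2 ?_)⟩
        exact (Relation.reflTransGen_iff_eq_or_transGen.1 hd).resolve_left (by simp)
      | .fail =>
        refine ⟨_, .alap2 (plus_iff_transGen.2 ?_)⟩
        exact (Relation.reflTransGen_iff_eq_or_transGen.1 hd).resolve_left (by simp)
      | .run Q H =>
        obtain ⟨rfl, -⟩ := hp.run_eq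
        exact ⟨_, .alap3 (star_iff_reflTransGen.2 hd)⟩
    · cases hd with
      | alap1 hd =>
        obtain ⟨m, hm, hH⟩ := hP.result_of_reach (plus_iff_transGen.1 hd).to_reflTransGen
        exact ih m hm _ hH
      | alap2 hd => exact always_result (hP.fail_of_reach (plus_iff_transGen.1 hd).to_reflTransGen)
      | alap3 hd => exact always_result (hP.break_of_reach (star_iff_reflTransGen.1 hd))

theorem alap_call (Inv : ℕ → HostGraph N → Prop)
    (h : ∀ n G H, Inv n G → Derives S G H → ∃ m < n, Inv m H) {n : ℕ} (hG : Inv n G) :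
    Spec (.alap (.call S)) G (fun H => (∃ m ≤ n, Inv m H) ∧ ¬ ∃ H', Derives S H H') B F := by
  -- The bound `k ≤ n` is carried along so that an enclosing loop can compare variants across this
  -- inner loop.
  refine alap (P := .call S) (fun k H => k ≤ n ∧ Inv k H) ?_ n G ⟨le_rfl, hG⟩
  rintro k H ⟨hk, hH⟩
  refine .call (fun H' hd => ?_) fun hd => ⟨⟨k, hk, hH⟩, hd⟩
  obtain ⟨m, hm, hH'⟩ := h k H H' hH hd
  exact ⟨m, hm, hm.le.trans hk, hH'⟩

/-- Divergence contradicts accessibility. A stuck configuration would be terminal and still carry a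
program, which `Post` permits only for `break`, and here no `break` is allowed. -/
theorem bot_notMem_sem (h : Spec P G R (fun _ => False) F) : Outcome.bot ∉ sem P G := by
  rintro (⟨c, hc, hs⟩ | ⟨Q, H, hQ, hs⟩)
  · have key : ∀ d, Acc (fun d c : Config N => Step c d) d → ∀ n, c n ≠ d := by
      intro d hd
      induction hd with
      | intro d _ ih => exact fun n hn => ih (c (n + 1)) (hn ▸ hs n) (n + 1) rfl
    exact key _ h.acc 0 hc
  · exact ((h.reach hQ).post hs).run_eq.2

theorem of_mem_sem (h : Spec P G R (fun _ => False) F) {o : Outcome N} (ho : o ∈ sem P G) :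
    (∃ H, o = .graph H ∧ R H) ∨ o = .fail ∧ F := by
  match o with
  | .graph H => exact .inl ⟨H, rfl, h.result_of_reach (Relation.TransGen.to_reflTransGen ho)⟩
  | .fail => exact .inr ⟨rfl, h.fail_of_reach (Relation.TransGen.to_reflTransGen ho)⟩
  | .bot => exact absurd ho h.bot_notMem_sem

theorem sem_nonempty (h : Spec P G R (fun _ => False) F) : (sem P G).Nonempty := by
  obtain ⟨d, hd, hp, -⟩ := h.exists_post
  match d with
  | .result H =>
    exact ⟨.graph H, (Relation.reflTransGen_iff_eq_or_transGen.1 hd).resolve_left (by simp)⟩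
  | .fail => exact ⟨.fail, (Relation.reflTransGen_iff_eq_or_transGen.1 hd).resolve_left (by simp)⟩
  | .run Q H => exact hp.run_eq.2.elim

end Spec

/-! ### Rule applications -/

namespace Rule

/-- No nodes are deleted, and the right-hand side is a graph with distinct node identifiers. -/
structure IsPreserving (r : Rule) : Prop where
  subset : ∀ i ∈ r.lhs.ids, i ∈ r.rhs.ids
  nodup : r.rhs.ids.Nodup
  edge_mem : ∀ e ∈ r.rhs.edges, e.src ∈ r.rhs.ids ∧ e.tgt ∈ r.rhs.ids

variable {r : Rule} {ι : Instantiation N} {G H : HostGraph N}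

/-- Without deleted nodes the dangling condition is vacuous, so any match can be carried out:
overwrite the attributes of the nodes of the right-hand side and exchange the matched edges. -/
theorem exists_applies (hr : r.IsPreserving) (nodup : (r.rhs.ids.map ι.node).Nodup)
    (lhs_node : ∀ n ∈ r.lhs.nodes, G.node (ι.node n.id) = some (ι.attr n))
    (fresh : ∀ i ∈ r.rhs.ids, i ∉ r.lhs.ids → G.node (ι.node i) = none)
    (le : Multiset.ofList (r.lhs.edges.map ι.edge) ≤ G.edges) :
    ∃ H, r.Applies ι G H := by
  classical
  have inj : ∀ i ∈ r.rhs.ids, ∀ j ∈ r.rhs.ids, ι.node i = ι.node j → i = j :=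
    fun i hi j hj => List.inj_on_of_nodup_map nodup hi hj
  obtain ⟨M, hM⟩ := Multiset.le_iff_exists_add.1 le
  -- The choice is harmless: identifiers are distinct and `ι.node` is injective on them, so at most
  -- one rule node lies over `w`.
  let f : N → Option NodeAttr := fun w =>
    if h : ∃ n ∈ r.rhs.nodes, ι.node n.id = w then some (ι.attr h.choose) else G.node w
  have hf : ∀ n ∈ r.rhs.nodes, f (ι.node n.id) = some (ι.attr n) := by
    intro n hn
    have h : ∃ n' ∈ r.rhs.nodes, ι.node n'.id = ι.node n.id := ⟨n, hn, rfl⟩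
    have hc := h.choose_spec
    have : h.choose = n := List.inj_on_of_nodup_map hr.nodup hc.1 hn
      (inj _ (List.mem_map_of_mem hc.1) _ (List.mem_map_of_mem hn) hc.2)
    simp only [f, dif_pos h, this]
  have hid : ∀ i ∈ r.rhs.ids, f (ι.node i) ≠ none := by
    intro i hi
    obtain ⟨n, hn, rfl⟩ := List.mem_map.1 hi
    simp [hf n hn]
  have hG : ∀ w, G.node w ≠ none → f w ≠ none := by
    intro w hw
    simp only [f]
    split_ifs <;> simp [hw]
  have hmem : ∀ i, i ∈ r.lhs.ids ∨ i ∈ r.rhs.ids → i ∈ r.rhs.ids :=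
    fun i hi => hi.elim (hr.subset i) id
  refine ⟨⟨f, M + Multiset.ofList (r.rhs.edges.map ι.edge), ?_, ?_⟩, ?_, lhs_node, fresh,
    ⟨M, by rw [hM, add_comm], rfl, fun i hi hi' => absurd (hr.subset i hi) hi'⟩, hf,
    fun i hi hi' => absurd (hr.subset i hi) hi', ?_⟩
  · refine (G.finite_nodes.union (r.rhs.ids.map ι.node).toFinset.finite_toSet).subset fun w hw => ?_
    by_cases h : ∃ n ∈ r.rhs.nodes, ι.node n.id = w
    · obtain ⟨n, hn, rfl⟩ := h
      right
      simpa [RuleGraph.ids] using ⟨n, hn, rfl⟩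
    · left
      simpa [f, h] using hw
  · intro e he
    rcases Multiset.mem_add.1 he with he | he
    · have := G.edge_mem e (by rw [hM]; exact Multiset.mem_add.2 (.inr he))
      exact ⟨hG _ this.1, hG _ this.2⟩
    · obtain ⟨e', he', rfl⟩ := List.mem_map.1 (Multiset.mem_coe.1 he)
      have := hr.edge_mem e' he'
      unfold Instantiation.edge
      split_ifs
      · exact ⟨hid _ this.2, hid _ this.1⟩
      · exact ⟨hid _ this.1, hid _ this.2⟩
  · exact fun i hi j hj hij => inj i (hmem i hi) j (hmem j hj) hij
  · intro w hw
    refine dif_neg ?_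
    rintro ⟨n, hn, rfl⟩
    exact hw n.id (.inr (List.mem_map_of_mem hn)) rfl

namespace Applies

theorem node_ne (h : r.Applies ι G H) (i j : ℕ) (hi : i ∈ r.rhs.ids) (hj : j ∈ r.rhs.ids)
    (hij : i ≠ j) : ι.node i ≠ ι.node j :=
  fun h' => hij (h.inj (.inr hi) (.inr hj) h')

/-- A rule node that is literally the same on both sides is rewritten to the attributes it already
had. Thus only rule nodes that change need to be excluded. -/
theorem node_eq (h : r.Applies ι G H) (hs : ∀ i ∈ r.lhs.ids, i ∈ r.rhs.ids) {w : N}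
    (hw : ∀ n ∈ r.rhs.nodes, w = ι.node n.id → n ∈ r.lhs.nodes) : H.node w = G.node w := by
  by_cases hn : ∃ n ∈ r.rhs.nodes, w = ι.node n.id
  · obtain ⟨n, hn, rfl⟩ := hn
    rw [h.rhs_node n hn, h.lhs_node n (hw n hn rfl)]
  · refine h.unchanged w fun i hi hiw => hn ?_
    obtain ⟨n, hn, rfl⟩ := List.mem_map.1 (hi.elim (hs i) id)
    exact ⟨n, hn, hiw.symm⟩

end Applies

end Rule

theorem derives_singleton {r : Rule} {G H : HostGraph N} :
    Derives [r] G H ↔ ∃ ι, r.Applies ι G H := by simp [Derives]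

theorem derives_cons {r : Rule} {S : List Rule} {G H : HostGraph N} :
    Derives (r :: S) G H ↔ Derives [r] G H ∨ Derives S G H := by simp [Derives]

theorem Rule.IsPreserving.exists_derives {r : Rule} {G : HostGraph N} (hr : r.IsPreserving)
    (ι : Instantiation N) (hs : ∀ i ∈ r.rhs.ids, i ∈ r.lhs.ids)
    (nodup : (r.rhs.ids.map ι.node).Nodup)
    (lhs_node : ∀ n ∈ r.lhs.nodes, G.node (ι.node n.id) = some (ι.attr n))
    (le : Multiset.ofList (r.lhs.edges.map ι.edge) ≤ G.edges) : ∃ H, Derives [r] G H := by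
  obtain ⟨H, h⟩ := Rule.exists_applies hr nodup lhs_node (fun i hi hi' => absurd (hs i hi) hi') le
  exact ⟨H, derives_singleton.2 ⟨ι, h⟩⟩

theorem pair_le_of_mem {α : Type*} {a b : α} {s : Multiset α} (ha : a ∈ s) (hb : b ∈ s)
    (hab : a ≠ b) : Multiset.ofList [a, b] ≤ s :=
  (Multiset.cons_le_of_notMem (by simpa using hab)).2 ⟨ha, Multiset.singleton_le.2 hb⟩

theorem single_le_of_mem {α : Type*} {a : α} {s : Multiset α} (ha : a ∈ s) :
    Multiset.ofList [a] ≤ s := Multiset.singleton_le.2 ha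

theorem HostGraph.ne_of_node {G : HostGraph N} {u v : N} {A B : NodeAttr} (hu : G.node u = some A)
    (hv : G.node v = some B) (h : A ≠ B) : u ≠ v := by
  rintro rfl
  exact h (Option.some.inj (hu.symm.trans hv))

/-- The edge `e` joins `u` and `v`, in either direction. -/
def Joins (e : Edge N) (u v : N) : Prop := e.src = u ∧ e.tgt = v ∨ e.src = v ∧ e.tgt = u

/-- The edge `e` with its mark replaced by `dashed`. -/
def Edge.dash (e : Edge N) : Edge N := { e with mark := .dashed }

/-- The unlabelled edge from `u` to `v` with mark `m`. -/
def Edge.plain (m : EdgeMark) (u v : N) : Edge N := ⟨u, v, [], m⟩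

/-- The orientation bit depends only on how `e` lies between `u` and `v`, not on the mark or the
instantiation, so it can be fixed before the instantiation is built. -/
theorem Joins.exists_flip {e : Edge N} {u v : N} (h : Joins e u v) : ∃ f, ∀ (ι : Instantiation N) m,
    ι.node 1 = u → ι.node 2 = v → ι.val .a = e.label → ι.flip 1 2 = f →
    ι.edge (TopSort.link 1 2 .a m) = { e with mark := m } := by
  obtain ⟨s, t, l, m⟩ := e
  rcases h with ⟨rfl, rfl⟩ | ⟨rfl, rfl⟩
  · refine ⟨false, fun ι m h1 h2 ha hf => ?_⟩
    simp [Instantiation.edge, TopSort.link, hf, h1, h2, Instantiation.eval, ha]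
  · refine ⟨true, fun ι m h1 h2 ha hf => ?_⟩
    simp [Instantiation.edge, TopSort.link, hf, h1, h2, Instantiation.eval, ha]

theorem Instantiation.joins_link (ι : Instantiation N) (m : EdgeMark) :
    Joins (ι.edge (TopSort.link 1 2 .a m)) (ι.node 1) (ι.node 2) := by
  unfold edge
  split_ifs
  · exact .inr ⟨rfl, rfl⟩
  · exact .inl ⟨rfl, rfl⟩

theorem Instantiation.mark_link (ι : Instantiation N) (m : EdgeMark) :
    (ι.edge (TopSort.link 1 2 .a m)).mark = m := by
  unfold edge
  split_ifs <;> rfl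

theorem Instantiation.dash_link (ι : Instantiation N) (m : EdgeMark) :
    ι.edge (TopSort.link 1 2 .a .dashed) = (ι.edge (TopSort.link 1 2 .a m)).dash := by
  by_cases h : ι.flip 1 2 <;> simp [edge, TopSort.link, h, Edge.dash]

/-! ### Applicability and effect of the individual rules -/

namespace TopSort

/-- An instantiation of all variables, marks and nodes of a rule. -/
def inst (u v w q : N) (x y z a b : Label) (m : NodeMark) (f : Bool) : Instantiation N where
  val
    | .a => a
    | .b => b
    | .x => x
    | .y => y
    | .z => z
  mark _ := m
  flip _ _ := f
  node
    | 1 => u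
    | 2 => v
    | 3 => w
    | _ => q

variable {G H : HostGraph N} {u v w q : N} {x y z a b : Label} {m : NodeMark}

open HostGraph (ne_of_node)
open Edge (plain)

theorem exists_derives_flag :
    (∃ H, Derives [flag] G H) ↔ ∃ u x, G.node u = some ⟨x, .unmarked, true⟩ := by
  constructor
  · rintro ⟨H, h⟩
    obtain ⟨ι, h⟩ := derives_singleton.1 h
    exact ⟨_, _, h.lhs_node (root 1 .x .unmarked) (.head _)⟩
  · rintro ⟨u, x, hu⟩
    refine Rule.IsPreserving.exists_derives ⟨by decide, by decide, by decide⟩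
      (inst u u u u x x x x x .red false) (by decide) (List.nodup_singleton u) ?_
      (Multiset.zero_le _)
    simp only [flag, List.forall_mem_cons]
    exact ⟨hu, nofun⟩

theorem exists_init [Infinite N] (hu : G.node u = some ⟨x, .grey, false⟩) :
    ∃ H, Derives [init] G H := by
  -- The infinite supply of names enters here: the pointer needs an unused one.
  obtain ⟨q, hq⟩ := G.finite_nodes.exists_notMem
  have hq : G.node q = none := by simpa using hq
  have huq : u ≠ q := by rintro rfl; simp [hu] at hq
  obtain ⟨H, h⟩ := Rule.exists_applies (r := init) (G := G)
    (ι := inst u q u u x x x x x .red false) ⟨by decide, by decide, by decide⟩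
    (show [u, q].Nodup by simpa using huq)
    (by simp only [init, List.forall_mem_cons]; exact ⟨hu, nofun⟩)
    (fun i hi hi' => by
      obtain rfl : i = 2 := by
        rcases List.mem_cons.1 hi with rfl | hi
        · exact absurd (.head _) hi'
        · exact List.mem_singleton.1 hi
      exact hq) (Multiset.zero_le _)
  exact ⟨H, derives_singleton.2 ⟨_, h⟩⟩

theorem derives_init (h : Derives [init] G H) : ∃ u q x, u ≠ q ∧
    G.node u = some ⟨x, .grey, false⟩ ∧ G.node q = none ∧
    H.edges = G.edges + {plain .red q u} ∧
    H.node u = some ⟨x, .red, true⟩ ∧ H.node q = some ⟨[], .green, true⟩ ∧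
    ∀ w, w ≠ u → w ≠ q → H.node w = G.node w := by
  obtain ⟨ι, h⟩ := derives_singleton.1 h
  obtain ⟨M, hM, hM', -⟩ := h.edges
  have hl := h.lhs_node
  have hr := h.rhs_node
  simp only [init, List.forall_mem_cons] at hl hr
  obtain ⟨h1, -⟩ := hl
  obtain ⟨h1', h2', -⟩ := hr
  refine ⟨ι.node 1, ι.node 2, ι.val .x, h.node_ne 1 2 (by decide) (by decide) (by decide), h1,
    h.fresh 2 (by decide) (by decide), ?_, h1', h2', fun w hw1 hw2 => h.node_eq (by decide) ?_⟩
  · rw [hM']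
    exact congrArg (· + _) (hM.trans (add_zero _)).symm
  · simp only [init, List.forall_mem_cons]
    exact ⟨fun h => absurd h hw1, fun h => absurd h hw2, nofun⟩

/-- Here `w` plays the top of the red stack. Matches are injective, so a top equal to the root calls
for `forward1` and any other top for `forward2`; the two rules cover all cases. -/
theorem exists_stackForward {e : Edge N} (hu : G.node u = some ⟨x, .red, true⟩)
    (hv : G.node v = some ⟨y, .grey, false⟩) (hq : G.node q = some ⟨[], .green, true⟩)
    (hw : w = u ∨ ∃ z, G.node w = some ⟨z, .red, false⟩) (hm : e.mark = .unmarked)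
    (hj : Joins e u v) (he : e ∈ G.edges) (hr : plain .red q w ∈ G.edges) :
    ∃ H, Derives [forward1, forward2] G H := by
  have huv := ne_of_node hu hv (by simp)
  have huq := ne_of_node hu hq (by simp)
  have hvq := ne_of_node hv hq (by simp)
  obtain ⟨f, hf⟩ := hj.exists_flip
  have he' : ({ e with mark := .unmarked } : Edge N) = e := by rw [← hm]
  have hne : e ≠ plain .red q w := by rintro rfl; simp [plain] at hm
  simp only [derives_cons (S := [forward2]), exists_or]
  rcases hw with rfl | ⟨z, hw⟩
  · left
    refine Rule.IsPreserving.exists_derives ⟨by decide, by decide, by decide⟩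
      (inst w v q q x y x e.label x .red f) (by decide) (show [w, v, q].Nodup by simp [*]) ?_ ?_
    · simp only [forward1, List.forall_mem_cons]
      exact ⟨hu, hv, hq, nofun⟩
    · simp only [forward1, List.map_cons]
      rw [hf _ _ rfl rfl rfl rfl, he']
      exact pair_le_of_mem he hr hne
  · right
    have huw := ne_of_node hu hw (by simp)
    have hvw := ne_of_node hv hw (by simp)
    have hwq := ne_of_node hw hq (by simp)
    refine Rule.IsPreserving.exists_derives ⟨by decide, by decide, by decide⟩
      (inst u v w q x y z e.label x .red f) (by decide) (show [u, v, w, q].Nodup by simp [*]) ?_ ?_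
    · simp only [forward2, List.forall_mem_cons]
      exact ⟨hu, hv, hw, hq, nofun⟩
    · simp only [forward2, List.map_cons]
      rw [hf _ _ rfl rfl rfl rfl, he']
      exact pair_le_of_mem he hr hne

/-- The two rules have the same effect once `w` may coincide with `u`, so later arguments need not
distinguish them. -/
theorem derives_stackForward (h : Derives [forward1, forward2] G H) :
    ∃ u v w q x y e M, [u, v, q].Nodup ∧
    G.node u = some ⟨x, .red, true⟩ ∧ G.node v = some ⟨y, .grey, false⟩ ∧
    G.node q = some ⟨[], .green, true⟩ ∧ e.mark = .unmarked ∧ Joins e u v ∧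
    G.edges = M + {e} + {plain .red q w} ∧
    H.edges = M + {e.dash} + {plain .red q v} + {plain .red v w} ∧
    H.node u = some ⟨x, .red, false⟩ ∧ H.node v = some ⟨y, .red, true⟩ ∧
    ∀ w, w ≠ u → w ≠ v → H.node w = G.node w := by
  rcases derives_cons.1 h with h | h
  · obtain ⟨ι, h⟩ := derives_singleton.1 h
    obtain ⟨M, hM, hM', -⟩ := h.edges
    have hl := h.lhs_node
    have hr := h.rhs_node
    simp only [forward1, List.forall_mem_cons] at hl hr
    obtain ⟨h1, h2, h3, -⟩ := hl
    obtain ⟨h1', h2', h3', -⟩ := hr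
    have h12 := h.node_ne 1 2 (by decide) (by decide) (by decide)
    have h13 := h.node_ne 1 3 (by decide) (by decide) (by decide)
    have h23 := h.node_ne 2 3 (by decide) (by decide) (by decide)
    refine ⟨ι.node 1, ι.node 2, ι.node 1, ι.node 3, ι.val .x, ι.val .y,
      ι.edge (link 1 2 .a .unmarked), M, by simp [*], h1, h2, h3, ι.mark_link _, ι.joins_link _,
      ?_, ?_, h1', h2', fun w hw1 hw2 => h.node_eq (by decide) ?_⟩
    · rw [hM, add_assoc]; rfl
    · rw [hM', ← ι.dash_link, add_assoc, add_assoc]; rfl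
    · simp only [forward1, List.forall_mem_cons]
      exact ⟨fun h => absurd h hw1, fun h => absurd h hw2, fun _ => by simp, nofun⟩
  · obtain ⟨ι, h⟩ := derives_singleton.1 h
    obtain ⟨M, hM, hM', -⟩ := h.edges
    have hl := h.lhs_node
    have hr := h.rhs_node
    simp only [forward2, List.forall_mem_cons] at hl hr
    obtain ⟨h1, h2, h3, h4, -⟩ := hl
    obtain ⟨h1', h2', h3', h4', -⟩ := hr
    have h12 := h.node_ne 1 2 (by decide) (by decide) (by decide)
    have h14 := h.node_ne 1 4 (by decide) (by decide) (by decide)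
    have h24 := h.node_ne 2 4 (by decide) (by decide) (by decide)
    refine ⟨ι.node 1, ι.node 2, ι.node 3, ι.node 4, ι.val .x, ι.val .y,
      ι.edge (link 1 2 .a .unmarked), M, by simp [*], h1, h2, h4, ι.mark_link _, ι.joins_link _,
      ?_, ?_, h1', h2', fun w hw1 hw2 => h.node_eq (by decide) ?_⟩
    · rw [hM, add_assoc]; rfl
    · rw [hM', ← ι.dash_link, add_right_comm, add_assoc, add_assoc]; rfl
    · simp only [forward2, List.forall_mem_cons]
      exact ⟨fun h => absurd h hw1, fun h => absurd h hw2, fun _ => by simp, fun _ => by simp,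
        nofun⟩

theorem exists_back {e : Edge N} (hu : G.node u = some ⟨x, .red, false⟩)
    (hv : G.node v = some ⟨y, .red, true⟩) (hj : Joins e u v) (he : e.dash ∈ G.edges) :
    ∃ H, Derives [back] G H := by
  have huv := ne_of_node hu hv (by simp)
  obtain ⟨f, hf⟩ := hj.exists_flip
  refine Rule.IsPreserving.exists_derives ⟨by decide, by decide, by decide⟩
    (inst u v v v x y x e.label x .red f) (by decide) (show [u, v].Nodup by simp [*]) ?_ ?_
  · simp only [back, List.forall_mem_cons]
    exact ⟨hu, hv, nofun⟩
  · simp only [back, List.map_cons]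
    rw [hf _ _ rfl rfl rfl rfl]
    exact single_le_of_mem he

theorem derives_back (h : Derives [back] G H) :
    ∃ u v x y e M, u ≠ v ∧ G.node u = some ⟨x, .red, false⟩ ∧ G.node v = some ⟨y, .red, true⟩ ∧
    e.mark = .unmarked ∧ Joins e u v ∧ G.edges = M + {e.dash} ∧ H.edges = M + {e} ∧
    H.node u = some ⟨x, .red, true⟩ ∧ H.node v = some ⟨y, .red, false⟩ ∧
    ∀ w, w ≠ u → w ≠ v → H.node w = G.node w := by
  obtain ⟨ι, h⟩ := derives_singleton.1 h
  obtain ⟨M, hM, hM', -⟩ := h.edges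
  have hl := h.lhs_node
  have hr := h.rhs_node
  simp only [back, List.forall_mem_cons] at hl hr
  obtain ⟨h1, h2, -⟩ := hl
  obtain ⟨h1', h2', -⟩ := hr
  refine ⟨ι.node 1, ι.node 2, ι.val .x, ι.val .y, ι.edge (link 1 2 .a .unmarked), M,
    h.node_ne 1 2 (by decide) (by decide) (by decide), h1, h2, ι.mark_link _, ι.joins_link _,
    ?_, hM', h1', h2', fun w hw1 hw2 => h.node_eq (by decide) ?_⟩
  · rw [← ι.dash_link, hM]; rfl
  · simp only [back, List.forall_mem_cons]
    exact ⟨fun h => absurd h hw1, fun h => absurd h hw2, nofun⟩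

theorem exists_unroot (hu : G.node u = some ⟨x, .red, true⟩) : ∃ H, Derives [unroot] G H := by
  refine Rule.IsPreserving.exists_derives ⟨by decide, by decide, by decide⟩
    (inst u u u u x x x x x .red false) (by decide) (List.nodup_singleton u) ?_ (Multiset.zero_le _)
  simp only [unroot, List.forall_mem_cons]
  exact ⟨hu, nofun⟩

theorem derives_unroot (h : Derives [unroot] G H) : ∃ u x, G.node u = some ⟨x, .red, true⟩ ∧
    H.edges = G.edges ∧ H.node u = some ⟨x, .red, false⟩ ∧ ∀ w, w ≠ u → H.node w = G.node w := by
  obtain ⟨ι, h⟩ := derives_singleton.1 h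
  obtain ⟨M, hM, hM', -⟩ := h.edges
  refine ⟨ι.node 1, ι.val .x, h.lhs_node (root 1 .x .red) (.head _), hM'.trans hM.symm,
    h.rhs_node (node 1 .x .red) (.head _), fun w hw => h.node_eq (by decide) ?_⟩
  simp only [unroot, List.forall_mem_cons]
  exact ⟨fun h => absurd h hw, nofun⟩

theorem exists_setFlag (hu : G.node u = some ⟨x, .grey, true⟩) : ∃ H, Derives [setFlag] G H := by
  refine Rule.IsPreserving.exists_derives ⟨by decide, by decide, by decide⟩
    (inst u u u u x x x x x .red false) (by decide) (List.nodup_singleton u) ?_ (Multiset.zero_le _)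
  simp only [setFlag, List.forall_mem_cons]
  exact ⟨hu, nofun⟩

theorem derives_setFlag (h : Derives [setFlag] G H) :
    ∃ u x, H.node u = some ⟨x, .unmarked, true⟩ := by
  obtain ⟨ι, h⟩ := derives_singleton.1 h
  exact ⟨_, _, h.rhs_node (root 1 .x .unmarked) (.head _)⟩

theorem exists_skip1 (hu : G.node u = some ⟨x, .blue, false⟩) (hv : G.node v = some ⟨y, m, false⟩)
    (hq : G.node q = some ⟨z, .green, true⟩) (huv : u ≠ v) (he : plain .red u v ∈ G.edges)
    (he' : plain .red q u ∈ G.edges) : ∃ H, Derives [skip1] G H := by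
  have huq := ne_of_node hu hq (by simp)
  have hvq := ne_of_node hv hq (by simp)
  refine Rule.IsPreserving.exists_derives ⟨by decide, by decide, by decide⟩
    (inst u v q q x y z x x m false) (by decide) (show [u, v, q].Nodup by simp [*]) ?_
    (pair_le_of_mem he he' fun h => huq (congrArg Edge.src h))
  simp only [skip1, List.forall_mem_cons]
  exact ⟨hu, hv, hq, nofun⟩

theorem derives_skip1 (h : Derives [skip1] G H) : ∃ u v q x z M,
    G.node u = some ⟨x, .blue, false⟩ ∧ G.node q = some ⟨z, .green, true⟩ ∧
    G.edges = M + {plain .red u v} + {plain .red q u} ∧ H.edges = M + {plain .red q v} ∧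
    ∀ w, H.node w = G.node w := by
  obtain ⟨ι, h⟩ := derives_singleton.1 h
  obtain ⟨M, hM, hM', -⟩ := h.edges
  refine ⟨ι.node 1, ι.node 2, ι.node 3, ι.val .x, ι.val .z, M,
    h.lhs_node (node 1 .x .blue) (.head _),
    h.lhs_node (root 3 .z .green) (.tail _ (.tail _ (.head _))),
    ?_, hM', fun w => h.node_eq (by decide) fun n hn _ => hn⟩
  rw [hM, add_assoc]; rfl

theorem exists_skip2 (hu : G.node u = some ⟨x, .blue, false⟩)
    (hq : G.node q = some ⟨y, .green, true⟩) (he : plain .red q u ∈ G.edges) :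
    ∃ H, Derives [skip2] G H := by
  have huq := ne_of_node hu hq (by simp)
  refine Rule.IsPreserving.exists_derives ⟨by decide, by decide, by decide⟩
    (inst u q q q x y x x x .red false) (by decide) (show [u, q].Nodup by simp [*]) ?_
    (single_le_of_mem he)
  simp only [skip2, List.forall_mem_cons]
  exact ⟨hu, hq, nofun⟩

theorem derives_skip2 (h : Derives [skip2] G H) : ∃ u q x z,
    G.node u = some ⟨x, .blue, false⟩ ∧ G.node q = some ⟨z, .green, true⟩ ∧
    G.edges = H.edges + {plain .red q u} ∧ ∀ w, H.node w = G.node w := by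
  obtain ⟨ι, h⟩ := derives_singleton.1 h
  obtain ⟨M, hM, hM', -⟩ := h.edges
  refine ⟨ι.node 1, ι.node 2, ι.val .x, ι.val .y,
    h.lhs_node (node 1 .x .blue) (.head _), h.lhs_node (root 2 .y .green) (.tail _ (.head _)),
    ?_, fun w => h.node_eq (by decide) fun n hn _ => hn⟩
  rw [hM.trans (congrArg (· + _) (hM'.trans (add_zero _)).symm)]; rfl

theorem exists_init1 (hu : G.node u = some ⟨x, .red, false⟩) (hv : G.node v = some ⟨y, m, false⟩)
    (hq : G.node q = some ⟨z, .green, true⟩) (huv : u ≠ v) (he : plain .red u v ∈ G.edges)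
    (he' : plain .red q u ∈ G.edges) : ∃ H, Derives [init1] G H := by
  have huq := ne_of_node hu hq (by simp)
  have hvq := ne_of_node hv hq (by simp)
  refine Rule.IsPreserving.exists_derives ⟨by decide, by decide, by decide⟩
    (inst u v q q x y z x x m false) (by decide) (show [u, v, q].Nodup by simp [*]) ?_
    (pair_le_of_mem he he' fun h => huq (congrArg Edge.src h))
  simp only [init1, List.forall_mem_cons]
  exact ⟨hu, hv, hq, nofun⟩

theorem derives_init1 (h : Derives [init1] G H) : ∃ u v q x z M,
    G.node u = some ⟨x, .red, false⟩ ∧ G.node q = some ⟨z, .green, true⟩ ∧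
    G.edges = M + {plain .red u v} + {plain .red q u} ∧ H.edges = M + {plain .red q v} ∧
    H.node u = some ⟨x, .grey, true⟩ ∧ ∀ w, w ≠ u → H.node w = G.node w := by
  obtain ⟨ι, h⟩ := derives_singleton.1 h
  obtain ⟨M, hM, hM', -⟩ := h.edges
  refine ⟨ι.node 1, ι.node 2, ι.node 3, ι.val .x, ι.val .z, M,
    h.lhs_node (node 1 .x .red) (.head _),
    h.lhs_node (root 3 .z .green) (.tail _ (.tail _ (.head _))),
    ?_, hM', h.rhs_node (root 1 .x .grey) (.head _), fun w hw => h.node_eq (by decide) ?_⟩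
  · rw [hM, add_assoc]; rfl
  · simp only [init1, List.forall_mem_cons]
    exact ⟨fun h => absurd h hw, fun _ => by simp, fun _ => by simp,
        nofun⟩

theorem exists_init2 (hu : G.node u = some ⟨x, .red, false⟩)
    (hq : G.node q = some ⟨y, .green, true⟩) (he : plain .red q u ∈ G.edges) :
    ∃ H, Derives [init2] G H := by
  have huq := ne_of_node hu hq (by simp)
  refine Rule.IsPreserving.exists_derives ⟨by decide, by decide, by decide⟩
    (inst u q q q x y x x x .red false) (by decide) (show [u, q].Nodup by simp [*]) ?_
    (single_le_of_mem he)
  simp only [init2, List.forall_mem_cons]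
  exact ⟨hu, hq, nofun⟩

theorem derives_init2 (h : Derives [init2] G H) : ∃ u q x z,
    G.node u = some ⟨x, .red, false⟩ ∧ G.node q = some ⟨z, .green, true⟩ ∧
    G.edges = H.edges + {plain .red q u} ∧
    H.node u = some ⟨x, .grey, true⟩ ∧ ∀ w, w ≠ u → H.node w = G.node w := by
  obtain ⟨ι, h⟩ := derives_singleton.1 h
  obtain ⟨M, hM, hM', -⟩ := h.edges
  refine ⟨ι.node 1, ι.node 2, ι.val .x, ι.val .y,
    h.lhs_node (node 1 .x .red) (.head _), h.lhs_node (root 2 .y .green) (.tail _ (.head _)),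
    ?_, h.rhs_node (root 1 .x .grey) (.head _), fun w hw => h.node_eq (by decide) ?_⟩
  · rw [hM.trans (congrArg (· + _) (hM'.trans (add_zero _)).symm)]; rfl
  · simp only [init2, List.forall_mem_cons]
    exact ⟨fun h => absurd h hw, fun _ => by simp, nofun⟩

theorem exists_forward (hu : G.node u = some ⟨x, .grey, true⟩)
    (hv : G.node v = some ⟨y, .red, false⟩) (he : ⟨u, v, a, .unmarked⟩ ∈ G.edges) :
    ∃ H, Derives [forward] G H := by
  have huv := ne_of_node hu hv (by simp)
  refine Rule.IsPreserving.exists_derives ⟨by decide, by decide, by decide⟩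
    (inst u v v v x y x a x .red false) (by decide) (show [u, v].Nodup by simp [*]) ?_
    (single_le_of_mem he)
  simp only [forward, List.forall_mem_cons]
  exact ⟨hu, hv, nofun⟩

theorem derives_forward (h : Derives [forward] G H) : ∃ u v x y e M, u ≠ v ∧
    G.node u = some ⟨x, .grey, true⟩ ∧ G.node v = some ⟨y, .red, false⟩ ∧
    e.src = u ∧ e.tgt = v ∧ e.mark = .unmarked ∧
    G.edges = M + {e} ∧ H.edges = M + {e.dash} ∧
    H.node u = some ⟨x, .grey, false⟩ ∧ H.node v = some ⟨y, .grey, true⟩ ∧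
    ∀ w, w ≠ u → w ≠ v → H.node w = G.node w := by
  obtain ⟨ι, h⟩ := derives_singleton.1 h
  obtain ⟨M, hM, hM', -⟩ := h.edges
  have hl := h.lhs_node
  have hr := h.rhs_node
  simp only [forward, List.forall_mem_cons] at hl hr
  obtain ⟨h1, h2, -⟩ := hl
  obtain ⟨h1', h2', -⟩ := hr
  refine ⟨ι.node 1, ι.node 2, ι.val .x, ι.val .y, ⟨ι.node 1, ι.node 2, ι.val .a, .unmarked⟩, M,
    h.node_ne 1 2 (by decide) (by decide) (by decide), h1, h2, rfl, rfl, rfl, hM, hM', h1', h2',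
    fun w hw1 hw2 => h.node_eq (by decide) ?_⟩
  simp only [forward, List.forall_mem_cons]
  exact ⟨fun h => absurd h hw1, fun h => absurd h hw2, nofun⟩

theorem exists_loop (hu : G.node u = some ⟨x, .grey, true⟩)
    (he : ⟨u, u, a, .unmarked⟩ ∈ G.edges) : ∃ H, Derives [loop, twoCycle, backEdge] G H := by
  simp only [derives_cons (S := [twoCycle, backEdge]), exists_or]
  left
  refine Rule.IsPreserving.exists_derives ⟨by decide, by decide, by decide⟩
    (inst u u u u x x x a x .red false) (by decide) (List.nodup_singleton u) ?_
    (single_le_of_mem he)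
  simp only [loop, List.forall_mem_cons]
  exact ⟨hu, nofun⟩

theorem exists_twoCycle (hu : G.node u = some ⟨x, .grey, false⟩)
    (hv : G.node v = some ⟨y, .grey, true⟩) (he : ⟨u, v, a, .dashed⟩ ∈ G.edges)
    (he' : ⟨v, u, b, .unmarked⟩ ∈ G.edges) : ∃ H, Derives [loop, twoCycle, backEdge] G H := by
  have huv := ne_of_node hu hv (by simp)
  simp only [derives_cons (S := [twoCycle, backEdge]), derives_cons (S := [backEdge]), exists_or]
  right; left
  refine Rule.IsPreserving.exists_derives ⟨by decide, by decide, by decide⟩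
    (inst u v v v x y x a b .red false) (by decide) (show [u, v].Nodup by simp [*]) ?_
    (pair_le_of_mem he he' fun h =>
      absurd (show EdgeMark.dashed = .unmarked from congrArg Edge.mark h) (by decide))
  simp only [twoCycle, List.forall_mem_cons]
  exact ⟨hu, hv, nofun⟩

theorem exists_backEdge (hu : G.node u = some ⟨x, .grey, false⟩)
    (hv : G.node v = some ⟨y, .grey, true⟩) (hw : G.node w = some ⟨z, .grey, false⟩) (huw : u ≠ w)
    (he : ⟨v, w, a, .unmarked⟩ ∈ G.edges) (he' : ⟨w, u, b, .dashed⟩ ∈ G.edges) :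
    ∃ H, Derives [loop, twoCycle, backEdge] G H := by
  have huv := ne_of_node hu hv (by simp)
  have hvw := ne_of_node hv hw (by simp)
  simp only [derives_cons (S := [twoCycle, backEdge]), derives_cons (S := [backEdge]), exists_or]
  right; right
  refine Rule.IsPreserving.exists_derives ⟨by decide, by decide, by decide⟩
    (inst u v w w x y z a b .red false) (by decide) (show [u, v, w].Nodup by simp [*]) ?_
    (pair_le_of_mem he he' fun h =>
      absurd (show EdgeMark.unmarked = .dashed from congrArg Edge.mark h) (by decide))
  simp only [backEdge, List.forall_mem_cons]
  exact ⟨hu, hv, hw, nofun⟩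

/-- Only the common content of the three rules matters: an unmarked edge from the root to a grey
node. It suffices because grey nodes lie on the search path. -/
theorem derives_cycle (h : Derives [loop, twoCycle, backEdge] G H) : ∃ u v e x y r,
    G.node u = some ⟨x, .grey, true⟩ ∧ G.node v = some ⟨y, .grey, r⟩ ∧
    e ∈ G.edges ∧ e.mark = .unmarked ∧ e.src = u ∧ e.tgt = v := by
  have key : ∀ (M K : Multiset (Edge N)) e, e ∈ K → e ∈ M + K :=
    fun M K e he => Multiset.mem_add.2 (.inr he)
  rcases derives_cons.1 h with h | h
  · obtain ⟨ι, h⟩ := derives_singleton.1 h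
    obtain ⟨M, hM, -, -⟩ := h.edges
    exact ⟨ι.node 1, ι.node 1, ⟨ι.node 1, ι.node 1, ι.val .a, .unmarked⟩, _, _, _,
      h.lhs_node (root 1 .x .grey) (.head _), h.lhs_node (root 1 .x .grey) (.head _),
      by rw [hM]; exact key _ _ _ (Multiset.mem_coe.2 (.head _)), rfl, rfl, rfl⟩
  rcases derives_cons.1 h with h | h
  · obtain ⟨ι, h⟩ := derives_singleton.1 h
    obtain ⟨M, hM, -, -⟩ := h.edges
    exact ⟨ι.node 2, ι.node 1, ⟨ι.node 2, ι.node 1, ι.val .b, .unmarked⟩, _, _, _,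
      h.lhs_node (root 2 .y .grey) (.tail _ (.head _)), h.lhs_node (node 1 .x .grey) (.head _),
      by rw [hM]; exact key _ _ _ (Multiset.mem_coe.2 (.tail _ (.head _))), rfl, rfl, rfl⟩
  · obtain ⟨ι, h⟩ := derives_singleton.1 h
    obtain ⟨M, hM, -, -⟩ := h.edges
    exact ⟨ι.node 2, ι.node 3, ⟨ι.node 2, ι.node 3, ι.val .a, .unmarked⟩, _, _, _,
      h.lhs_node (root 2 .y .grey) (.tail _ (.head _)),
      h.lhs_node (node 3 .z .grey) (.tail _ (.tail _ (.head _))),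
      by rw [hM]; exact key _ _ _ (Multiset.mem_coe.2 (.head _)), rfl, rfl, rfl⟩

theorem exists_greyFirstPush (hq : G.node q = some ⟨[], .green, true⟩)
    (hu : G.node u = some ⟨x, .grey, true⟩) : ∃ H, Derives [greyFirstPush] G H := by
  have hqu := ne_of_node hq hu (by simp)
  refine Rule.IsPreserving.exists_derives ⟨by decide, by decide, by decide⟩
    (inst q u u u x x x x x .red false) (by decide) (show [q, u].Nodup by simp [*]) ?_
    (Multiset.zero_le _)
  simp only [greyFirstPush, List.forall_mem_cons]
  exact ⟨hq, hu, nofun⟩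

theorem derives_greyFirstPush (h : Derives [greyFirstPush] G H) : ∃ q u x, q ≠ u ∧
    G.node q = some ⟨[], .green, true⟩ ∧ G.node u = some ⟨x, .grey, true⟩ ∧
    H.edges = G.edges + {plain .blue q u} ∧
    H.node q = some ⟨zero, .green, true⟩ ∧ H.node u = some ⟨x, .blue, false⟩ ∧
    ∀ w, w ≠ q → w ≠ u → H.node w = G.node w := by
  obtain ⟨ι, h⟩ := derives_singleton.1 h
  obtain ⟨M, hM, hM', -⟩ := h.edges
  have hl := h.lhs_node
  have hr := h.rhs_node
  simp only [greyFirstPush, List.forall_mem_cons] at hl hr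
  obtain ⟨h1, h2, -⟩ := hl
  obtain ⟨h1', h2', -⟩ := hr
  refine ⟨ι.node 1, ι.node 2, ι.val .x, h.node_ne 1 2 (by decide) (by decide) (by decide), h1, h2,
    hM'.trans (congrArg (· + _) (hM.trans (add_zero _)).symm), h1', h2',
    fun w hw1 hw2 => h.node_eq (by decide) ?_⟩
  simp only [greyFirstPush, List.forall_mem_cons]
  exact ⟨fun h => absurd h hw1, fun h => absurd h hw2, nofun⟩

theorem exists_greyPush (hu : G.node u = some ⟨x, .grey, true⟩)
    (hv : G.node v = some ⟨y, .blue, false⟩) (hq : G.node q = some ⟨zero, .green, true⟩)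
    (he : plain .blue q v ∈ G.edges) : ∃ H, Derives [greyPush] G H := by
  have huv := ne_of_node hu hv (by simp)
  have huq := ne_of_node hu hq (by simp)
  have hvq := ne_of_node hv hq (by simp)
  refine Rule.IsPreserving.exists_derives ⟨by decide, by decide, by decide⟩
    (inst u v q q x y x x x .red false) (by decide) (show [u, v, q].Nodup by simp [*]) ?_
    (single_le_of_mem he)
  simp only [greyPush, List.forall_mem_cons]
  exact ⟨hu, hv, hq, nofun⟩

theorem derives_greyPush (h : Derives [greyPush] G H) : ∃ u v q x M,
    G.node u = some ⟨x, .grey, true⟩ ∧ G.node q = some ⟨zero, .green, true⟩ ∧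
    G.edges = M + {plain .blue q v} ∧ H.edges = M + {plain .blue q u} + {plain .blue u v} ∧
    H.node u = some ⟨x, .blue, false⟩ ∧ ∀ w, w ≠ u → H.node w = G.node w := by
  obtain ⟨ι, h⟩ := derives_singleton.1 h
  obtain ⟨M, hM, hM', -⟩ := h.edges
  refine ⟨ι.node 1, ι.node 2, ι.node 3, ι.val .x, M, h.lhs_node (root 1 .x .grey) (.head _),
    h.lhs_node (pointer 3 zero) (.tail _ (.tail _ (.head _))), hM, ?_,
    h.rhs_node (node 1 .x .blue) (.head _), fun w hw => h.node_eq (by decide) ?_⟩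
  · rw [hM', add_assoc]; rfl
  · simp only [greyPush, List.forall_mem_cons]
    exact ⟨fun h => absurd h hw, fun _ => by simp, fun _ => by simp,
        nofun⟩

theorem exists_backFirstPush (hu : G.node u = some ⟨x, .grey, false⟩)
    (hv : G.node v = some ⟨y, .grey, true⟩) (hq : G.node q = some ⟨[], .green, true⟩)
    (he : ⟨u, v, a, .dashed⟩ ∈ G.edges) : ∃ H, Derives [backFirstPush] G H := by
  have huv := ne_of_node hu hv (by simp)
  have huq := ne_of_node hu hq (by simp)
  have hvq := ne_of_node hv hq (by simp)
  refine Rule.IsPreserving.exists_derives ⟨by decide, by decide, by decide⟩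
    (inst u v q q x y x a x .red false) (by decide) (show [u, v, q].Nodup by simp [*]) ?_
    (single_le_of_mem he)
  simp only [backFirstPush, List.forall_mem_cons]
  exact ⟨hu, hv, hq, nofun⟩

theorem derives_backFirstPush (h : Derives [backFirstPush] G H) : ∃ u v q x y e M, [u, v, q].Nodup ∧
    G.node u = some ⟨x, .grey, false⟩ ∧ G.node v = some ⟨y, .grey, true⟩ ∧
    G.node q = some ⟨[], .green, true⟩ ∧ e.src = u ∧ e.tgt = v ∧ e.mark = .unmarked ∧
    G.edges = M + {e.dash} ∧ H.edges = M + {e} + {plain .blue q v} ∧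
    H.node u = some ⟨x, .grey, true⟩ ∧ H.node v = some ⟨y, .blue, false⟩ ∧
    H.node q = some ⟨zero, .green, true⟩ ∧
    ∀ w, w ≠ u → w ≠ v → w ≠ q → H.node w = G.node w := by
  obtain ⟨ι, h⟩ := derives_singleton.1 h
  obtain ⟨M, hM, hM', -⟩ := h.edges
  have hl := h.lhs_node
  have hr := h.rhs_node
  simp only [backFirstPush, List.forall_mem_cons] at hl hr
  obtain ⟨h1, h2, h3, -⟩ := hl
  obtain ⟨h1', h2', h3', -⟩ := hr
  have h12 := h.node_ne 1 2 (by decide) (by decide) (by decide)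
  have h13 := h.node_ne 1 3 (by decide) (by decide) (by decide)
  have h23 := h.node_ne 2 3 (by decide) (by decide) (by decide)
  refine ⟨ι.node 1, ι.node 2, ι.node 3, ι.val .x, ι.val .y,
    ⟨ι.node 1, ι.node 2, ι.val .a, .unmarked⟩, M, by simp [*], h1, h2, h3, rfl, rfl, rfl, hM, ?_,
    h1', h2', h3', fun w hw1 hw2 hw3 => h.node_eq (by decide) ?_⟩
  · rw [hM', add_assoc]; rfl
  · simp only [backFirstPush, List.forall_mem_cons]
    exact ⟨fun h => absurd h hw1, fun h => absurd h hw2, fun h => absurd h hw3, nofun⟩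

theorem exists_backPush (hu : G.node u = some ⟨x, .grey, false⟩)
    (hv : G.node v = some ⟨y, .grey, true⟩) (hq : G.node q = some ⟨zero, .green, true⟩)
    (hw : G.node w = some ⟨z, .blue, false⟩) (he : ⟨u, v, a, .dashed⟩ ∈ G.edges)
    (he' : plain .blue q w ∈ G.edges) : ∃ H, Derives [backPush] G H := by
  have huv := ne_of_node hu hv (by simp)
  have huq := ne_of_node hu hq (by simp)
  have hvq := ne_of_node hv hq (by simp)
  have huw := ne_of_node hu hw (by simp)
  have hvw := ne_of_node hv hw (by simp)
  have hqw := ne_of_node hq hw (by simp)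
  refine Rule.IsPreserving.exists_derives ⟨by decide, by decide, by decide⟩
    (inst u v q w x y z a x .red false) (by decide) (show [u, v, q, w].Nodup by simp [*]) ?_
    (pair_le_of_mem he he' fun h =>
      absurd (show EdgeMark.dashed = .blue from congrArg Edge.mark h) (by decide))
  simp only [backPush, List.forall_mem_cons]
  exact ⟨hu, hv, hq, hw, nofun⟩

theorem derives_backPush (h : Derives [backPush] G H) : ∃ u v q w x y e M, [u, v, q].Nodup ∧
    G.node u = some ⟨x, .grey, false⟩ ∧ G.node v = some ⟨y, .grey, true⟩ ∧
    G.node q = some ⟨zero, .green, true⟩ ∧ e.src = u ∧ e.tgt = v ∧ e.mark = .unmarked ∧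
    G.edges = M + {e.dash} + {plain .blue q w} ∧
    H.edges = M + {e} + {plain .blue q v} + {plain .blue v w} ∧
    H.node u = some ⟨x, .grey, true⟩ ∧ H.node v = some ⟨y, .blue, false⟩ ∧
    ∀ w, w ≠ u → w ≠ v → H.node w = G.node w := by
  obtain ⟨ι, h⟩ := derives_singleton.1 h
  obtain ⟨M, hM, hM', -⟩ := h.edges
  have hl := h.lhs_node
  have hr := h.rhs_node
  simp only [backPush, List.forall_mem_cons] at hl hr
  obtain ⟨h1, h2, h3, -⟩ := hl
  obtain ⟨h1', h2', h3', -⟩ := hr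
  have h12 := h.node_ne 1 2 (by decide) (by decide) (by decide)
  have h13 := h.node_ne 1 3 (by decide) (by decide) (by decide)
  have h23 := h.node_ne 2 3 (by decide) (by decide) (by decide)
  refine ⟨ι.node 1, ι.node 2, ι.node 3, ι.node 4, ι.val .x, ι.val .y,
    ⟨ι.node 1, ι.node 2, ι.val .a, .unmarked⟩, M, by simp [*], h1, h2, h3, rfl, rfl, rfl, ?_, ?_,
    h1', h2', fun w hw1 hw2 => h.node_eq (by decide) ?_⟩
  · rw [hM, add_assoc]; rfl
  · rw [hM', add_assoc, add_assoc]; rfl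
  · simp only [backPush, List.forall_mem_cons]
    exact ⟨fun h => absurd h hw1, fun h => absurd h hw2, fun _ => by simp, fun _ => by simp,
        nofun⟩

end TopSort

open Edge (plain)

/-! ### The shape of intermediate graphs -/

/-- The unlabelled edges with mark `m` of the path that starts in `u` and continues along the
list. -/
def pathEdges (m : EdgeMark) : N → List N → Multiset (Edge N)
  | _, [] => 0
  | u, v :: l => {plain m u v} + pathEdges m v l

theorem bluePath_eq_pathEdges (u : N) (l : List N) : bluePath u l = pathEdges .blue u l := by
  induction l generalizing u with
  | nil => rfl
  | cons v l ih => exact congrArg (_ ::ₘ ·) (ih v)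

theorem mem_pathEdges {m : EdgeMark} {u : N} {l : List N} {e : Edge N} (h : e ∈ pathEdges m u l) :
    e.mark = m ∧ e.src ∈ u :: l ∧ e.tgt ∈ l := by
  induction l generalizing u with
  | nil => exact absurd h (Multiset.notMem_zero e)
  | cons v l ih =>
    rcases Multiset.mem_add.1 h with h | h
    · obtain rfl := Multiset.mem_singleton.1 h
      exact ⟨rfl, .head _, .head _⟩
    · obtain ⟨h1, h2, h3⟩ := ih h
      exact ⟨h1, .tail _ h2, .tail _ h3⟩

/-- Since `u` does not recur, only the first edge of the path can start there. For the pointer this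
says that a matched stack edge leads to the top of the stack. -/
theorem exists_cons_of_mem_pathEdges {m : EdgeMark} {u v : N} {l : List N}
    (h : plain m u v ∈ pathEdges m u l) (hu : u ∉ l) : ∃ l', l = v :: l' := by
  cases l with
  | nil => exact absurd h (Multiset.notMem_zero _)
  | cons w l =>
    rcases Multiset.mem_add.1 h with h | h
    · obtain rfl : v = w := congrArg Edge.tgt (Multiset.mem_singleton.1 h)
      exact ⟨l, rfl⟩
    · exact absurd (mem_pathEdges h).2.1 hu

open Classical in
/-- The graph `H` consists of the nodes of `G`, coloured according to `col`, among which only `r` is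
a root, and of the pointer `p` with label `lab`. Its edges are those of `G`, where those in
the list `ds` are dashed, together with the red path from `p` along `rl` and the blue path from `p`
along `bl`. -/
structure Shape (G H : HostGraph N) (p : N) (lab : Label) (col : N → NodeMark) (r : Option N)
    (U : Multiset (Edge N)) (ds : List (Edge N)) (rl bl : List N) : Prop where
  unmarked : ∀ e ∈ G.edges, e.mark = .unmarked
  fresh : G.node p = none
  ne_green : ∀ v, col v ≠ .green
  pointer : H.node p = some ⟨lab, .green, true⟩
  node : ∀ v, v ≠ p → H.node v = (G.node v).map fun a => ⟨a.label, col v, decide (r = some v)⟩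
  split : G.edges = U + ds
  edges : H.edges = U + (ds.map Edge.dash) + pathEdges .red p rl + pathEdges .blue p bl
  red_mem : ∀ v ∈ rl, G.node v ≠ none
  blue_mem : ∀ v ∈ bl, G.node v ≠ none
  red_nodup : rl.Nodup
  blue_nodup : bl.Nodup

namespace Shape

variable {G H H' : HostGraph N} {p : N} {lab : Label} {col : N → NodeMark} {r : Option N}
  {U : Multiset (Edge N)} {ds : List (Edge N)} {rl bl : List N} {v w : N} {l : Label}
  {m : NodeMark} {b : Bool} {e : Edge N}

theorem ne_pointer (S : Shape G H p lab col r U ds rl bl) (hv : G.node v ≠ none) : v ≠ p := by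
  rintro rfl
  exact hv S.fresh

/-- The pointer is green, so a matched node with another mark comes from `G`, and its mark and
rootedness can be read off from `col` and `r`. -/
theorem node_eq (S : Shape G H p lab col r U ds rl bl) (h : H.node v = some ⟨l, m, b⟩)
    (hm : m ≠ .green) : v ≠ p ∧ (∃ a, G.node v = some a ∧ a.label = l) ∧ col v = m ∧
      (b = true ↔ r = some v) := by
  have hv : v ≠ p := by
    rintro rfl
    rw [S.pointer] at h
    simp only [Option.some.injEq, NodeAttr.mk.injEq] at h
    exact hm h.2.1.symm
  rw [S.node v hv] at h
  obtain ⟨a, ha, h⟩ := Option.map_eq_some_iff.1 h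
  simp only [NodeAttr.mk.injEq] at h
  refine ⟨hv, ⟨a, ha, h.1⟩, h.2.1, ?_⟩
  rw [← h.2.2]
  simp

theorem eq_pointer (S : Shape G H p lab col r U ds rl bl) (h : H.node v = some ⟨l, .green, b⟩) :
    v = p ∧ l = lab := by
  by_cases hv : v = p
  · subst hv
    rw [S.pointer] at h
    simp only [Option.some.injEq, NodeAttr.mk.injEq] at h
    exact ⟨rfl, h.1.symm⟩
  · rw [S.node v hv] at h
    obtain ⟨a, ha, h⟩ := Option.map_eq_some_iff.1 h
    simp only [NodeAttr.mk.injEq] at h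
    exact absurd h.2.1 (S.ne_green v)

theorem exists_node (S : Shape G H p lab col r U ds rl bl) (h : G.node v ≠ none)
    (hb : b = true ↔ r = some v) : ∃ l, H.node v = some ⟨l, col v, b⟩ := by
  obtain ⟨a, ha⟩ := Option.ne_none_iff_exists'.1 h
  refine ⟨a.label, ?_⟩
  rw [S.node v (S.ne_pointer h), ha]
  simp only [Option.map_some, Option.some.injEq, NodeAttr.mk.injEq, true_and]
  by_cases h : r = some v <;> simp_all

theorem mem_edges (S : Shape G H p lab col r U ds rl bl) : e ∈ H.edges ↔
    e ∈ U ∨ (∃ d ∈ ds, d.dash = e) ∨ e ∈ pathEdges .red p rl ∨ e ∈ pathEdges .blue p bl := by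
  rw [S.edges]
  simp [or_assoc]

theorem mark_of_mem (S : Shape G H p lab col r U ds rl bl) (h : e ∈ U) : e.mark = .unmarked :=
  S.unmarked e (by rw [S.split]; exact Multiset.mem_add.2 (.inl h))

theorem mark_of_mem_dashed (S : Shape G H p lab col r U ds rl bl) (h : e ∈ ds) :
    e.mark = .unmarked :=
  S.unmarked e (by rw [S.split]; exact Multiset.mem_add.2 (.inr h))

theorem mem_unmarked (S : Shape G H p lab col r U ds rl bl) (h : e ∈ H.edges)
    (hm : e.mark = .unmarked) : e ∈ U := by
  rcases S.mem_edges.1 h with h | ⟨d, -, rfl⟩ | h | h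
  · exact h
  · exact nomatch hm
  · exact nomatch hm.symm.trans (mem_pathEdges h).1
  · exact nomatch hm.symm.trans (mem_pathEdges h).1

theorem mem_dashed (S : Shape G H p lab col r U ds rl bl) (h : e.dash ∈ H.edges)
    (hm : e.mark = .unmarked) : e ∈ ds := by
  rcases S.mem_edges.1 h with h | ⟨d, hd, h⟩ | h | h
  · exact nomatch S.mark_of_mem h
  -- `Edge.dash` forgets only the mark, and both edges were unmarked, so they are equal.
  · have hd' := S.mark_of_mem_dashed hd
    obtain ⟨_, _, _, _⟩ := e
    obtain ⟨_, _, _, _⟩ := d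
    cases hm
    cases hd'
    cases h
    exact hd
  · exact nomatch (mem_pathEdges h).1
  · exact nomatch (mem_pathEdges h).1

theorem mem_red (S : Shape G H p lab col r U ds rl bl) (h : plain .red v w ∈ H.edges) :
    plain .red v w ∈ pathEdges .red p rl := by
  rcases S.mem_edges.1 h with h | ⟨d, hd, h⟩ | h | h
  · exact nomatch S.mark_of_mem h
  · exact nomatch congrArg Edge.mark h
  · exact h
  · exact nomatch (mem_pathEdges h).1

theorem mem_blue (S : Shape G H p lab col r U ds rl bl) (h : plain .blue v w ∈ H.edges) :
    plain .blue v w ∈ pathEdges .blue p bl := by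
  rcases S.mem_edges.1 h with h | ⟨d, hd, h⟩ | h | h
  · exact nomatch S.mark_of_mem h
  · exact nomatch congrArg Edge.mark h
  · exact nomatch (mem_pathEdges h).1
  · exact h

theorem pointer_notMem_red (S : Shape G H p lab col r U ds rl bl) : p ∉ rl :=
  fun h => S.red_mem p h S.fresh

theorem pointer_notMem_blue (S : Shape G H p lab col r U ds rl bl) : p ∉ bl :=
  fun h => S.blue_mem p h S.fresh

theorem red_eq_cons (S : Shape G H p lab col r U ds rl bl) (h : plain .red p v ∈ H.edges) :
    ∃ l, rl = v :: l :=
  exists_cons_of_mem_pathEdges (S.mem_red h) S.pointer_notMem_red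

theorem blue_eq_cons (S : Shape G H p lab col r U ds rl bl) (h : plain .blue p v ∈ H.edges) :
    ∃ l, bl = v :: l :=
  exists_cons_of_mem_pathEdges (S.mem_blue h) S.pointer_notMem_blue

theorem red_eq_cons_cons (S : Shape G H p lab col r U ds rl bl) (h : plain .red p v ∈ H.edges)
    (h' : plain .red v w ∈ H.edges) : ∃ l, rl = v :: w :: l := by
  obtain ⟨l, rfl⟩ := S.red_eq_cons h
  have hv : v ≠ p := S.ne_pointer (S.red_mem v (.head _))
  obtain ⟨l', rfl⟩ := exists_cons_of_mem_pathEdges (l := l) (m := .red) (u := v) (v := w) (by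
    rcases Multiset.mem_add.1 (S.mem_red h') with h | h
    · exact absurd (congrArg Edge.src (Multiset.mem_singleton.1 h)) hv
    · exact h) (List.nodup_cons.1 S.red_nodup).1
  exact ⟨l', rfl⟩

theorem length_red_le (S : Shape G H p lab col r U ds rl bl) :
    rl.length ≤ G.finite_nodes.toFinset.card := by
  classical
  rw [← List.toFinset_card_of_nodup S.red_nodup]
  exact Finset.card_le_card fun v hv => by simpa using S.red_mem v (by simpa using hv)

theorem mem_of_mem_edges (S : Shape G H p lab col r U ds rl bl) (h : e ∈ U) : e ∈ G.edges := by
  rw [S.split]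
  exact Multiset.mem_add.2 (.inl h)

theorem mem_of_mem_dashed (S : Shape G H p lab col r U ds rl bl) (h : e ∈ ds) : e ∈ G.edges := by
  rw [S.split]
  exact Multiset.mem_add.2 (.inr h)

end Shape

/-! ### Dashed paths -/

/-- The list `ds` describes a path from the node `c`: its entries are edges that are related by `J`
to the next and the previous node, together with the next node. -/
def DashPath (J : Edge N → N → N → Prop) : N → List (Edge N × N) → Prop
  | _, [] => True
  | c, (e, u) :: ds => J e u c ∧ DashPath J u ds

/-- The edge `e` leads from `u` to `v`. -/
def Into (e : Edge N) (u v : N) : Prop := e.src = u ∧ e.tgt = v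

theorem DashPath.joins {c : N} {ds : List (Edge N × N)} (h : DashPath Into c ds) :
    DashPath Joins c ds := by
  induction ds generalizing c with
  | nil => trivial
  | cons d ds ih => exact ⟨.inl h.1, ih h.2⟩

theorem DashPath.mem_of_joins {c u v : N} {ds : List (Edge N × N)} {e : Edge N}
    (h : DashPath Joins c ds) (he : e ∈ ds.map Prod.fst) (hj : Joins e u v) :
    u ∈ c :: ds.map Prod.snd ∧ v ∈ c :: ds.map Prod.snd := by
  induction ds generalizing c with
  | nil => simp at he
  | cons d ds ih =>
    obtain ⟨e', w⟩ := d
    rcases List.mem_cons.1 he with he | he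
    · dsimp only at he
      subst he
      have h := h.1
      unfold Joins at h hj
      grind
    · have := ih h.2 he
      exact ⟨.tail _ this.1, .tail _ this.2⟩

/-- An edge further along the list has both ends among the later nodes, while the simple path never
returns to `c`. Hence backtracking has no choice: it undoes the edge by which `c` was reached. -/
theorem DashPath.eq_cons {c u : N} {ds : List (Edge N × N)} {e : Edge N}
    (h : DashPath Joins c ds) (hn : (c :: ds.map Prod.snd).Nodup) (he : e ∈ ds.map Prod.fst)
    (hj : Joins e u c) : ∃ ds', ds = (e, u) :: ds' := by
  cases ds with
  | nil => simp at he
  | cons d ds =>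
    obtain ⟨e', w⟩ := d
    rcases List.mem_cons.1 he with he | he
    · dsimp only at he
      subst he
      obtain rfl : u = w := by
        have h := h.1
        unfold Joins at h hj
        grind
      exact ⟨ds, rfl⟩
    · exact absurd (h.2.mem_of_joins he hj).2 (List.nodup_cons.1 hn).1

/-! ### Stacking the nodes -/

open Classical in
/-- The colouring while the nodes are pushed on the red stack. -/
noncomputable def stackColour (rl : List N) (v : N) : NodeMark := if v ∈ rl then .red else .grey

theorem stackColour_eq_red {rl : List N} {v : N} : stackColour rl v = .red ↔ v ∈ rl := by
  unfold stackColour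
  split_ifs <;> simp [*]

theorem stackColour_eq_grey {rl : List N} {v : N} : stackColour rl v = .grey ↔ v ∉ rl := by
  unfold stackColour
  split_ifs <;> simp [*]

theorem stackColour_ne_green (rl : List N) (v : N) : stackColour rl v ≠ .green := by
  unfold stackColour
  split_ifs <;> simp

theorem HostGraph.Arc.mem {G : HostGraph N} {u v : N} (h : G.Arc u v) :
    G.node u ≠ none ∧ G.node v ≠ none := by
  obtain ⟨e, he, rfl, rfl⟩ := h
  exact G.edge_mem e he

theorem exists_joins {G : HostGraph N} {u v : N} (h : G.Arc u v ∨ G.Arc v u) :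
    ∃ e ∈ G.edges, Joins e u v := by
  rcases h with ⟨e, he, h⟩ | ⟨e, he, h⟩
  · exact ⟨e, he, .inl h⟩
  · exact ⟨e, he, .inr h⟩

/-- The states of the undirected depth-first search that builds the red stack `rl`: the root is
`c`, and the search path is described by `ds`. -/
structure StackState (G H : HostGraph N) (p c : N) (U : Multiset (Edge N)) (ds : List (Edge N × N))
    (rl : List N) : Prop where
  shape : Shape G H p [] (stackColour rl) (some c) U (ds.map Prod.fst) rl []
  path : DashPath Joins c ds
  nodup : (c :: ds.map Prod.snd).Nodup
  mem : ∀ v ∈ c :: ds.map Prod.snd, v ∈ rl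
  finished : ∀ v ∈ rl, v ∉ c :: ds.map Prod.snd → ∀ w, G.Arc v w ∨ G.Arc w v → w ∈ rl

theorem HostGraph.IsInput.stackState {G H : HostGraph N} (hG : G.IsInput)
    (h : Derives [TopSort.init] G H) : ∃ p c, StackState G H p c G.edges [] [c] := by
  obtain ⟨c, p, x, hcp, hc, hp, hE, hc', hp', hn⟩ := TopSort.derives_init h
  refine ⟨p, c, ⟨hG.unmarked, hp, stackColour_ne_green _, hp', fun v hv => ?_, by simp,
    by simp [hE, pathEdges], by simp [hc], nofun, List.nodup_singleton c, .nil⟩, trivial,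
    List.nodup_singleton c, by simp, by simp +contextual⟩
  by_cases hvc : v = c
  · subst hvc
    simp [hc, hc', stackColour]
  · rw [hn v hvc hv]
    cases ha : G.node v with
    | none => rfl
    | some a =>
      obtain ⟨l, m, b⟩ := a
      obtain rfl := hG.grey v _ ha
      obtain rfl := hG.unrooted v _ ha
      simp [stackColour, hvc, Ne.symm hvc]

namespace StackState

variable {G H H' : HostGraph N} {p c : N} {U : Multiset (Edge N)} {ds : List (Edge N × N)}
  {rl : List N}

theorem node_root (S : StackState G H p c U ds rl) : ∃ l, H.node c = some ⟨l, .red, true⟩ := by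
  have hc : c ∈ rl := S.mem c (.head _)
  obtain ⟨l, h⟩ := S.shape.exists_node (b := true) (S.shape.red_mem c hc) (by simp)
  exact ⟨l, by rwa [stackColour_eq_red.2 hc] at h⟩

theorem forward (S : StackState G H p c U ds rl)
    (h : Derives [TopSort.forward1, TopSort.forward2] H H') :
    ∃ v e U', StackState G H' p v U' ((e, c) :: ds) (v :: rl) := by
  obtain ⟨u, v, q, w, x, y, e, M, hd, hu, hv, hq, hm, hj, hE, hE', hu', hv', hn⟩ :=
    TopSort.derives_stackForward h
  obtain ⟨-, -, -, hcu⟩ := S.shape.node_eq hu (by simp)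
  obtain rfl : c = u := by simpa using hcu
  obtain ⟨hvp, ⟨av, hGv, rfl⟩, hvr, -⟩ := S.shape.node_eq hv (by simp)
  have hvr := stackColour_eq_grey.1 hvr
  obtain ⟨rfl, -⟩ := S.shape.eq_pointer hq
  have hcr : c ∈ rl := S.mem c (.head _)
  have hvc : v ≠ c := fun h => hvr (h ▸ hcr)
  obtain ⟨t, rfl⟩ := S.shape.red_eq_cons (v := q) (by rw [hE]; simp)
  obtain ⟨U, rfl⟩ := Multiset.exists_cons_of_mem
    (S.shape.mem_unmarked (e := e) (by rw [hE]; simp) hm)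
  -- The edges outside the match are found by cancellation: the matched ones are `e`, split off from
  -- the unmarked edges, and the first edge of the red path.
  have hM : M = U + Multiset.ofList ((ds.map Prod.fst).map Edge.dash) + pathEdges .red q t := by
    have := S.shape.edges
    rw [hE] at this
    simp only [pathEdges, ← Multiset.singleton_add] at this
    refine add_right_cancel (b := {e} + {plain .red w q}) ?_
    rw [← add_assoc, this]
    abel
  refine ⟨v, e, U, ⟨S.shape.unmarked, S.shape.fresh, stackColour_ne_green _, ?_, fun z hz => ?_, ?_,
    ?_, ?_, nofun, ?_, .nil⟩, ⟨?_, S.path⟩, ?_, ?_, ?_⟩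
  · rw [hn w (S.shape.ne_pointer (S.shape.red_mem c hcr)).symm hvp.symm, S.shape.pointer]
  · by_cases hzc : z = c
    · subst hzc
      obtain ⟨-, ⟨a, ha, rfl⟩, -⟩ := S.shape.node_eq hu (by simp)
      simp [ha, hu', stackColour_eq_red.2 (List.mem_cons_of_mem v hcr), hvc]
    by_cases hzv : z = v
    · subst hzv
      simp [hv', hGv, stackColour]
    · rw [hn z hzc hzv, S.shape.node z hz]
      have hz : stackColour (v :: q :: t) z = stackColour (q :: t) z := by
        unfold stackColour
        congr 1
        exact propext (List.mem_cons.trans (or_iff_right hzv))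
      simp [hz, Ne.symm hzv, Ne.symm hzc]
  · rw [S.shape.split, ← Multiset.singleton_add]
    simp only [List.map_cons, ← Multiset.cons_coe, ← Multiset.singleton_add]
    abel
  · rw [hE', hM]
    simp only [List.map_cons, ← Multiset.cons_coe, ← Multiset.singleton_add, pathEdges]
    abel
  · exact List.forall_mem_cons.2 ⟨by simp [hGv], S.shape.red_mem⟩
  · exact List.nodup_cons.2 ⟨hvr, S.shape.red_nodup⟩
  · exact hj
  · exact List.nodup_cons.2 ⟨fun h => hvr (S.mem v h), S.nodup⟩
  · exact List.forall_mem_cons.2 ⟨.head _, fun z hz => .tail _ (S.mem z hz)⟩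
  · intro z hz hz' y hy
    simp only [List.map_cons, List.mem_cons, not_or] at hz'
    exact .tail _ (S.finished z ((List.mem_cons.1 hz).resolve_left hz'.1) (by simp [hz'.2]) y hy)

/-- Consider an edge between `c` and an unvisited node. If it is not dashed, one of the forward
rules applies to it; if it is dashed, both its ends are on the search path and therefore visited. -/
theorem closed (S : StackState G H p c U ds rl)
    (h : ¬ ∃ H', Derives [TopSort.forward1, TopSort.forward2] H H') {w : N}
    (hw : G.Arc c w ∨ G.Arc w c) : w ∈ rl := by
  by_contra hwr
  obtain ⟨e, he, hj⟩ := exists_joins hw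
  have hGw : G.node w ≠ none := hw.elim (fun h => h.mem.2) fun h => h.mem.1
  have hc : c ∈ rl := S.mem c (.head _)
  obtain ⟨lc, hHc⟩ := S.node_root
  obtain ⟨lw, hHw⟩ := S.shape.exists_node (b := false) hGw
    (by simpa using fun h : c = w => hwr (h ▸ hc))
  rw [stackColour_eq_grey.2 hwr] at hHw
  have hm := S.shape.unmarked e he
  rw [S.shape.split] at he
  rcases Multiset.mem_add.1 he with he | he
  · match rl, S with
    | u :: t, S =>
      refine h (TopSort.exists_stackForward hHc hHw S.shape.pointer (w := u) ?_ hm hj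
        (S.shape.mem_edges.2 (.inl he)) ?_)
      · by_cases huc : u = c
        · exact .inl huc
        · obtain ⟨l, hl⟩ := S.shape.exists_node (b := false) (S.shape.red_mem u (.head _))
            (by simpa using Ne.symm huc)
          rw [stackColour_eq_red.2 (.head _)] at hl
          exact .inr ⟨l, hl⟩
      · exact S.shape.mem_edges.2 (.inr (.inr (.inl (by simp [pathEdges]))))
  · exact hwr (S.mem w (S.path.mem_of_joins (Multiset.mem_coe.1 he) hj).2)

/-- Backtracking takes `c` off the search path and so brings it under the clause `finished`; `hc`
supplies what that clause demands of `c`. -/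
theorem back (S : StackState G H p c U ds rl) (hc : ∀ w, G.Arc c w ∨ G.Arc w c → w ∈ rl)
    (h : Derives [TopSort.back] H H') :
    ∃ e u ds' U', ds = (e, u) :: ds' ∧ StackState G H' p u U' ds' rl := by
  obtain ⟨u, v, x, y, e, M, huv, hu, hv, hm, hj, hE, hE', hu', hv', hn⟩ := TopSort.derives_back h
  obtain ⟨hcp, ⟨a, ha, rfl⟩, -, hcv⟩ := S.shape.node_eq hv (by simp)
  obtain rfl : c = v := by simpa using hcv
  obtain ⟨hup, ⟨b, hb, rfl⟩, hur, -⟩ := S.shape.node_eq hu (by simp)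
  have hur := stackColour_eq_red.1 hur
  have hcr : c ∈ rl := S.mem c (.head _)
  obtain ⟨ds, rfl⟩ := S.path.eq_cons S.nodup (S.shape.mem_dashed (by rw [hE]; simp) hm) hj
  have hM : M = U + Multiset.ofList ((ds.map Prod.fst).map Edge.dash) + pathEdges .red p rl := by
    have := S.shape.edges
    rw [hE] at this
    simp only [List.map_cons, ← Multiset.cons_coe, ← Multiset.singleton_add, pathEdges] at this
    refine add_right_cancel (b := {e.dash}) ?_
    rw [this]
    abel
  have hn' := List.nodup_cons.1 S.nodup
  refine ⟨e, u, ds, U + {e}, rfl, ⟨S.shape.unmarked, S.shape.fresh, stackColour_ne_green _, ?_,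
    fun z hz => ?_, ?_, ?_, S.shape.red_mem, nofun, S.shape.red_nodup, .nil⟩, S.path.2, hn'.2,
    fun z hz => S.mem z (.tail _ hz), ?_⟩
  · rw [hn p hup.symm hcp.symm, S.shape.pointer]
  · by_cases hzc : z = c
    · subst hzc
      simp [ha, hv', stackColour_eq_red.2 hcr, huv]
    by_cases hzu : z = u
    · subst hzu
      simp [hu', hb, stackColour_eq_red.2 hur]
    · rw [hn z hzu hzc, S.shape.node z hz]
      simp [Ne.symm hzu, Ne.symm hzc]
  · rw [S.shape.split]
    simp only [List.map_cons, ← Multiset.cons_coe, ← Multiset.singleton_add]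
    abel
  · rw [hE', hM]
    simp only [pathEdges]
    abel
  · intro z hz hz' y hy
    by_cases hzc : z = c
    · exact hc y (hzc ▸ hy)
    · exact S.finished z hz (fun h => (List.mem_cons.1 h).elim hzc hz') y hy

theorem exists_back {e : Edge N} {u : N} (S : StackState G H p c U ((e, u) :: ds) rl) :
    ∃ H', Derives [TopSort.back] H H' := by
  obtain ⟨lc, hc⟩ := S.node_root
  have hu : u ∈ rl := S.mem u (by simp)
  have huc : c ≠ u := by
    rintro rfl
    have := S.nodup
    simp at this
  obtain ⟨l, hl⟩ := S.shape.exists_node (b := false) (S.shape.red_mem u hu) (by simpa using huc)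
  rw [stackColour_eq_red.2 hu] at hl
  exact TopSort.exists_back hl hc S.path.1
    (S.shape.mem_edges.2 (.inr (.inl ⟨e, by simp, rfl⟩)))

/-- With the search path reduced to `c`, the red stack is closed under adjacency, so it absorbs
every node joined to `c`. -/
theorem mem_red (S : StackState G H p c U [] rl) (hG : G.IsConnected)
    (hc : ∀ w, G.Arc c w ∨ G.Arc w c → w ∈ rl) {v : N} (hv : G.node v ≠ none) : v ∈ rl := by
  have hcr : c ∈ rl := S.mem c (.head _)
  have := hG c v (S.shape.red_mem c hcr) hv
  induction this with
  | refl => exact hcr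
  | @tail b d _ hs ih =>
    have hb : b ∈ rl := ih (hs.elim (fun h => h.mem.1) fun h => h.mem.2)
    by_cases hbc : b = c
    · exact hc _ (hbc ▸ hs)
    · exact S.finished b hb (by simpa using hbc) _ hs

/-- The variant of the loop that builds the red stack. -/
noncomputable def variant (G : HostGraph N) (ds : List (Edge N × N)) (rl : List N) : ℕ :=
  2 * (G.finite_nodes.toFinset.card - rl.length) + ds.length

end StackState

theorem TopSort.spec_stackNodes {G : HostGraph N} (hG : G.IsConnected) {H : HostGraph N}
    (hH : ∃ p c U ds rl, StackState G H p c U ds rl) {B : HostGraph N → Prop} {F : Prop} :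
    Spec (.alap stackNodes) H
      (fun H => ∃ p c U rl, StackState G H p c U [] rl ∧ ∀ v, G.node v ≠ none → v ∈ rl) B F := by
  let Inv : ℕ → HostGraph N → Prop := fun n H =>
    ∃ p c U ds rl, StackState G H p c U ds rl ∧ n = StackState.variant G ds rl
  obtain ⟨p, c, U, ds, rl, S⟩ := hH
  refine Spec.alap Inv ?_ _ H ⟨p, c, U, ds, rl, S, rfl⟩
  intro n H hn
  refine .seq (.alap_call Inv ?_ hn) ?_
  · rintro n H H' ⟨p, c, U, ds, rl, S, rfl⟩ h
    obtain ⟨v, e, U', S'⟩ := S.forward h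
    refine ⟨_, ?_, p, v, U', _, _, S', rfl⟩
    -- The subtraction in the variant is truncated, so this bound is needed: a push lowers the
    -- doubled summand by two and lengthens the path by one.
    have := S'.shape.length_red_le
    simp only [StackState.variant, List.length_cons] at this ⊢
    omega
  · rintro H ⟨⟨m, hm, p, c, U, ds, rl, S, rfl⟩, hf⟩
    refine .trye_call (fun H' h => ?_) fun h => .brk ?_
    · obtain ⟨e, u, ds, U', rfl, S'⟩ := S.back (fun w hw => S.closed hf hw) h
      refine ⟨_, ?_, p, u, U', _, _, S', rfl⟩
      -- The strict decrease comes from `back` alone, which shortens the path; `hm` records that the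
      -- preceding forward loop did not raise the variant.
      simp only [StackState.variant, List.length_cons] at hm ⊢
      omega
    · match ds, S with
      | [], S => exact ⟨p, c, U, rl, S, fun v hv => S.mem_red hG (fun w hw => S.closed hf hw) hv⟩
      | _ :: _, S => exact absurd S.exists_back h

/-! ### Sorting the nodes -/

open Classical in
/-- The colouring while the nodes are moved to the blue stack `bl`; the nodes in `l` are those
on the current search path. -/
noncomputable def sortColour (bl l : List N) (v : N) : NodeMark :=
  if v ∈ bl then .blue else if v ∈ l then .grey else .red

section sortColour

variable {bl l : List N} {v : N}

theorem sortColour_eq_blue : sortColour bl l v = .blue ↔ v ∈ bl := by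
  unfold sortColour
  split_ifs <;> simp [*]

theorem sortColour_eq_grey : sortColour bl l v = .grey ↔ v ∉ bl ∧ v ∈ l := by
  unfold sortColour
  split_ifs <;> simp [*]

theorem sortColour_eq_red : sortColour bl l v = .red ↔ v ∉ bl ∧ v ∉ l := by
  unfold sortColour
  split_ifs <;> simp [*]

theorem sortColour_ne_green (bl l : List N) (v : N) : sortColour bl l v ≠ .green := by
  unfold sortColour
  split_ifs <;> simp

theorem sortColour_ne_unmarked (bl l : List N) (v : N) : sortColour bl l v ≠ .unmarked := by
  unfold sortColour
  split_ifs <;> simp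

theorem sortColour_congr {bl' l' : List N} (h : v ∈ bl ↔ v ∈ bl')
    (h' : v ∉ bl → (v ∈ l ↔ v ∈ l')) : sortColour bl l v = sortColour bl' l' v := by
  by_cases hv : v ∈ bl
  · rw [sortColour_eq_blue.2 hv, sortColour_eq_blue.2 (h.1 hv)]
  · by_cases hl : v ∈ l
    · rw [sortColour_eq_grey.2 ⟨hv, hl⟩, sortColour_eq_grey.2 ⟨mt h.2 hv, (h' hv).1 hl⟩]
    · rw [sortColour_eq_red.2 ⟨hv, hl⟩, sortColour_eq_red.2 ⟨mt h.2 hv, mt (h' hv).2 hl⟩]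

end sortColour

/-- The label of the pointer to the blue stack `bl`. -/
def pointerLabel : List N → Label
  | [] => []
  | _ :: _ => TopSort.zero

/-- The relation `A` relates members of the list only to members further down the list. -/
def SortedList (A : N → N → Prop) : List N → Prop
  | [] => True
  | u :: l => (∀ v, A u v → v ∈ l) ∧ SortedList A l

/-- The states between the directed searches. -/
structure LoopState (G H : HostGraph N) (p : N) (U : Multiset (Edge N)) (rl bl : List N) :
    Prop where
  shape : Shape G H p (pointerLabel bl) (sortColour bl []) none U [] rl bl
  red : ∀ v, G.node v ≠ none → v ∉ bl → v ∈ rl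
  sorted : SortedList G.Arc bl

/-- The states of the directed depth-first search with root `c` and search path `ds`. -/
structure SortState (G H : HostGraph N) (p c : N) (U : Multiset (Edge N)) (ds : List (Edge N × N))
    (rl bl : List N) : Prop where
  shape : Shape G H p (pointerLabel bl) (sortColour bl (c :: ds.map Prod.snd)) (some c) U
    (ds.map Prod.fst) rl bl
  path : DashPath Into c ds
  nodup : (c :: ds.map Prod.snd).Nodup
  mem : ∀ v ∈ c :: ds.map Prod.snd, G.node v ≠ none ∧ v ∉ bl
  red : ∀ v, G.node v ≠ none → v ∉ bl → v ∉ c :: ds.map Prod.snd → v ∈ rl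
  sorted : SortedList G.Arc bl

/-! ### Effect of the rules on the states of the directed searches -/

section SearchStates

variable {G H H' : HostGraph N} {p c : N} {U : Multiset (Edge N)} {ds : List (Edge N × N)}
  {rl bl : List N}

theorem StackState.unroot (S : StackState G H p c U [] rl) (hr : ∀ v, G.node v ≠ none → v ∈ rl)
    (h : Derives [TopSort.unroot] H H') : LoopState G H' p U rl [] := by
  obtain ⟨u, x, hu, hE, hu', hn⟩ := TopSort.derives_unroot h
  obtain ⟨hup, ⟨a, ha, rfl⟩, -, hcu⟩ := S.shape.node_eq hu (by simp)
  obtain rfl : c = u := by simpa using hcu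
  refine ⟨⟨S.shape.unmarked, S.shape.fresh, sortColour_ne_green _ _, ?_, fun z hz => ?_,
    S.shape.split, hE ▸ S.shape.edges, S.shape.red_mem, nofun, S.shape.red_nodup, .nil⟩,
    fun v hv _ => hr v hv, trivial⟩
  · rw [hn p hup.symm]
    exact S.shape.pointer
  · have hz' : sortColour [] [] z = .red := sortColour_eq_red.2 ⟨nofun, nofun⟩
    by_cases hzc : z = c
    · subst hzc
      simp [ha, hu', hz']
    · rw [hn z hzc, S.shape.node z hz]
      cases hGz : G.node z with
      | none => rfl
      | some a => simp [hz', stackColour_eq_red.2 (hr z (by simp [hGz])), Ne.symm hzc]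

namespace LoopState

/-- The common core of `skip1` and `skip2`. In `hE` each red path is added on the opposite side,
which avoids subtraction of multisets. -/
theorem skip {u : N} (S : LoopState G H p U (u :: rl) bl) (hu : u ∈ bl)
    (hn : ∀ w, H'.node w = H.node w)
    (hE : H'.edges + pathEdges .red p (u :: rl) = H.edges + pathEdges .red p rl) :
    LoopState G H' p U rl bl := by
  refine ⟨⟨S.shape.unmarked, S.shape.fresh, S.shape.ne_green, (hn p).trans S.shape.pointer,
    fun z hz => (hn z).trans (S.shape.node z hz), S.shape.split, ?_,
    fun v hv => S.shape.red_mem v (.tail _ hv), S.shape.blue_mem,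
    (List.nodup_cons.1 S.shape.red_nodup).2, S.shape.blue_nodup⟩, ?_, S.sorted⟩
  · refine add_right_cancel (b := pathEdges .red p (u :: rl)) ?_
    rw [hE, S.shape.edges]
    abel
  · intro v hv hvb
    exact (List.mem_cons.1 (S.red v hv hvb)).resolve_left fun h => hvb (h ▸ hu)

/-- The common core of `init1` and `init2`: the top of the red stack becomes a search path of a
single node. -/
theorem init {u : N} {x : Label} (S : LoopState G H p U (u :: rl) bl)
    (hu : H.node u = some ⟨x, .red, false⟩) (hu' : H'.node u = some ⟨x, .grey, true⟩)
    (hn : ∀ w, w ≠ u → H'.node w = H.node w)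
    (hE : H'.edges + pathEdges .red p (u :: rl) = H.edges + pathEdges .red p rl) :
    SortState G H' p u U [] rl bl := by
  obtain ⟨hup, ⟨a, ha, rfl⟩, hur, -⟩ := S.shape.node_eq hu (by simp)
  have hub := (sortColour_eq_red.1 hur).1
  refine ⟨⟨S.shape.unmarked, S.shape.fresh, sortColour_ne_green _ _,
    (hn p hup.symm).trans S.shape.pointer, fun z hz => ?_, S.shape.split, ?_,
    fun v hv => S.shape.red_mem v (.tail _ hv), S.shape.blue_mem,
    (List.nodup_cons.1 S.shape.red_nodup).2, S.shape.blue_nodup⟩, trivial, List.nodup_singleton u,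
    ?_, ?_, S.sorted⟩
  · by_cases hzu : z = u
    · subst hzu
      simp [ha, hu', sortColour_eq_grey.2 ⟨hub, List.mem_singleton_self z⟩]
    · rw [hn z hzu, S.shape.node z hz]
      have : sortColour bl [] z = sortColour bl [u] z :=
        sortColour_congr .rfl fun _ => by simp [hzu]
      simp [this, Ne.symm hzu]
  · refine add_right_cancel (b := pathEdges .red p (u :: rl)) ?_
    rw [hE, S.shape.edges]
    simp only [List.map_nil]
    abel
  · simp only [List.map_nil, List.forall_mem_singleton]
    exact ⟨by simp [ha], hub⟩
  · intro v hv hvb hvu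
    exact (List.mem_cons.1 (S.red v hv hvb)).resolve_left fun h => hvu (h ▸ .head _)

theorem mem_red_edges {u : N} (S : LoopState G H p U (u :: rl) bl) : plain .red p u ∈ H.edges :=
  S.shape.mem_edges.2 (.inr (.inr (.inl (by simp [pathEdges]))))

theorem mem_red_edges' {u v : N} (S : LoopState G H p U (u :: v :: rl) bl) :
    plain .red u v ∈ H.edges :=
  S.shape.mem_edges.2 (.inr (.inr (.inl (by simp [pathEdges]))))

theorem exists_node {u : N} (S : LoopState G H p U rl bl) (hu : u ∈ rl) :
    ∃ l, H.node u = some ⟨l, sortColour bl [] u, false⟩ :=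
  S.shape.exists_node (S.shape.red_mem u hu) (by simp)

theorem of_skip1 (S : LoopState G H p U rl bl) (h : Derives [TopSort.skip1] H H') :
    ∃ u t, rl = u :: t ∧ LoopState G H' p U t bl := by
  obtain ⟨u, v, q, x, z, M, hu, hq, hE, hE', hn⟩ := TopSort.derives_skip1 h
  obtain ⟨rfl, -⟩ := S.shape.eq_pointer hq
  obtain ⟨-, -, hub, -⟩ := S.shape.node_eq hu (by simp)
  obtain ⟨t, rfl⟩ := S.shape.red_eq_cons_cons (v := u) (w := v) (by rw [hE]; simp)
    (by rw [hE]; simp)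
  refine ⟨u, v :: t, rfl, S.skip (sortColour_eq_blue.1 hub) hn ?_⟩
  rw [hE, hE']
  simp only [pathEdges]
  abel

theorem exists_skip1 {u v : N} (S : LoopState G H p U (u :: v :: rl) bl) (hu : u ∈ bl) :
    ∃ H', Derives [TopSort.skip1] H H' := by
  obtain ⟨x, hx⟩ := S.exists_node (.head _)
  obtain ⟨y, hy⟩ := S.exists_node (.tail _ (.head _))
  rw [sortColour_eq_blue.2 hu] at hx
  refine TopSort.exists_skip1 hx hy S.shape.pointer ?_ S.mem_red_edges' S.mem_red_edges
  rintro rfl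
  simpa using S.shape.red_nodup

/-- The pattern of `skip2` ignores what lies below the top and would cut off the rest of a longer
red stack. The inapplicability of `skip1` rules this out; `of_init2` uses `init1` in the same way.
-/
theorem of_skip2 (S : LoopState G H p U rl bl) (h1 : ¬ ∃ H', Derives [TopSort.skip1] H H')
    (h : Derives [TopSort.skip2] H H') : ∃ u, rl = [u] ∧ LoopState G H' p U [] bl := by
  obtain ⟨u, q, x, z, hu, hq, hE, hn⟩ := TopSort.derives_skip2 h
  obtain ⟨rfl, -⟩ := S.shape.eq_pointer hq
  obtain ⟨-, -, hub, -⟩ := S.shape.node_eq hu (by simp)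
  have hub := sortColour_eq_blue.1 hub
  obtain ⟨t, rfl⟩ := S.shape.red_eq_cons (v := u) (by rw [hE]; simp)
  cases t with
  | cons _ _ => exact absurd (S.exists_skip1 hub) h1
  | nil =>
    refine ⟨u, rfl, S.skip hub hn ?_⟩
    rw [hE]
    simp [pathEdges]

theorem exists_skip2 {u : N} (S : LoopState G H p U (u :: rl) bl) (hu : u ∈ bl) :
    ∃ H', Derives [TopSort.skip2] H H' := by
  obtain ⟨x, hx⟩ := S.exists_node (.head _)
  rw [sortColour_eq_blue.2 hu] at hx
  exact TopSort.exists_skip2 hx S.shape.pointer S.mem_red_edges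

theorem of_init1 (S : LoopState G H p U rl bl) (h : Derives [TopSort.init1] H H') :
    ∃ u t, rl = u :: t ∧ SortState G H' p u U [] t bl := by
  obtain ⟨u, v, q, x, z, M, hu, hq, hE, hE', hu', hn⟩ := TopSort.derives_init1 h
  obtain ⟨rfl, -⟩ := S.shape.eq_pointer hq
  obtain ⟨t, rfl⟩ := S.shape.red_eq_cons_cons (v := u) (w := v) (by rw [hE]; simp)
    (by rw [hE]; simp)
  refine ⟨u, v :: t, rfl, S.init hu hu' hn ?_⟩
  rw [hE, hE']
  simp only [pathEdges]
  abel

theorem exists_init1 {u v : N} (S : LoopState G H p U (u :: v :: rl) bl) (hu : u ∉ bl) :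
    ∃ H', Derives [TopSort.init1] H H' := by
  obtain ⟨x, hx⟩ := S.exists_node (.head _)
  obtain ⟨y, hy⟩ := S.exists_node (.tail _ (.head _))
  rw [sortColour_eq_red.2 ⟨hu, List.not_mem_nil⟩] at hx
  refine TopSort.exists_init1 hx hy S.shape.pointer ?_ S.mem_red_edges' S.mem_red_edges
  rintro rfl
  simpa using S.shape.red_nodup

theorem of_init2 (S : LoopState G H p U rl bl) (h1 : ¬ ∃ H', Derives [TopSort.init1] H H')
    (h : Derives [TopSort.init2] H H') : ∃ u, rl = [u] ∧ SortState G H' p u U [] [] bl := by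
  obtain ⟨u, q, x, z, hu, hq, hE, hu', hn⟩ := TopSort.derives_init2 h
  obtain ⟨rfl, -⟩ := S.shape.eq_pointer hq
  obtain ⟨-, -, hur, -⟩ := S.shape.node_eq hu (by simp)
  obtain ⟨t, rfl⟩ := S.shape.red_eq_cons (v := u) (by rw [hE]; simp)
  cases t with
  | cons _ _ => exact absurd (S.exists_init1 (sortColour_eq_red.1 hur).1) h1
  | nil =>
    refine ⟨u, rfl, S.init hu hu' hn ?_⟩
    rw [hE]
    simp [pathEdges]

theorem exists_init2 {u : N} (S : LoopState G H p U (u :: rl) bl) (hu : u ∉ bl) :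
    ∃ H', Derives [TopSort.init2] H H' := by
  obtain ⟨x, hx⟩ := S.exists_node (.head _)
  rw [sortColour_eq_red.2 ⟨hu, List.not_mem_nil⟩] at hx
  exact TopSort.exists_init2 hx S.shape.pointer S.mem_red_edges

theorem not_flag (S : LoopState G H p U rl bl) : ¬ ∃ H', Derives [TopSort.flag] H H' := by
  rw [TopSort.exists_derives_flag]
  rintro ⟨u, x, hu⟩
  exact sortColour_ne_unmarked _ _ _ (S.shape.node_eq hu (by simp)).2.2.1

end LoopState

namespace SortState

variable {e : Edge N} {u : N}

theorem node_root (S : SortState G H p c U ds rl bl) : ∃ l, H.node c = some ⟨l, .grey, true⟩ := by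
  have hc := S.mem c (.head _)
  obtain ⟨l, h⟩ := S.shape.exists_node (b := true) hc.1 (by simp)
  exact ⟨l, by rwa [sortColour_eq_grey.2 ⟨hc.2, .head _⟩] at h⟩

theorem node_path (S : SortState G H p c U ds rl bl) {v : N} (hv : v ∈ ds.map Prod.snd) :
    v ≠ c ∧ ∃ l, H.node v = some ⟨l, .grey, false⟩ := by
  have hc := S.mem v (.tail _ hv)
  have hvc : v ≠ c := by
    rintro rfl
    exact (List.nodup_cons.1 S.nodup).1 hv
  obtain ⟨l, h⟩ := S.shape.exists_node (b := false) hc.1 (by simpa using hvc.symm)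
  exact ⟨hvc, l, by rwa [sortColour_eq_grey.2 ⟨hc.2, .tail _ hv⟩] at h⟩

/-- The blue stack and the search path are disjoint lists without repetition. This bounds both
variants of the directed search. -/
theorem length_le (S : SortState G H p c U ds rl bl) :
    bl.length + ds.length + 1 ≤ G.finite_nodes.toFinset.card := by
  classical
  have hn : (bl ++ c :: ds.map Prod.snd).Nodup :=
    List.nodup_append.2 ⟨S.shape.blue_nodup, S.nodup,
      fun a ha b hb hab => (S.mem b hb).2 (hab ▸ ha)⟩
  have := List.toFinset_card_of_nodup hn
  simp only [List.length_append, List.length_cons, List.length_map] at this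
  rw [add_assoc, ← this]
  refine Finset.card_le_card fun v hv => ?_
  rcases List.mem_append.1 (List.mem_toFinset.1 hv) with hv | hv
  · simpa using S.shape.blue_mem v hv
  · simpa using (S.mem v hv).1

theorem forward (S : SortState G H p c U ds rl bl) (h : Derives [TopSort.forward] H H') :
    ∃ v e U', SortState G H' p v U' ((e, c) :: ds) rl bl := by
  obtain ⟨u, v, x, y, e, M, hd, hu, hv, hes, het, hm, hE, hE', hu', hv', hn⟩ :=
    TopSort.derives_forward h
  obtain ⟨hcp, ⟨a, ha, rfl⟩, -, hcu⟩ := S.shape.node_eq hu (by simp)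
  obtain rfl : c = u := by simpa using hcu
  obtain ⟨hvp, ⟨b, hb, rfl⟩, hvr, -⟩ := S.shape.node_eq hv (by simp)
  obtain ⟨hvb, hvd⟩ := sortColour_eq_red.1 hvr
  have hcb := (S.mem c (.head _)).2
  obtain ⟨U, rfl⟩ := Multiset.exists_cons_of_mem
    (S.shape.mem_unmarked (e := e) (by rw [hE]; simp) hm)
  refine ⟨v, e, U, ⟨S.shape.unmarked, S.shape.fresh, sortColour_ne_green _ _,
    (hn p hcp.symm hvp.symm).trans S.shape.pointer, fun z hz => ?_, ?_, ?_, S.shape.red_mem,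
    S.shape.blue_mem, S.shape.red_nodup, S.shape.blue_nodup⟩, ⟨⟨hes, het⟩, S.path⟩,
    List.nodup_cons.2 ⟨hvd, S.nodup⟩, List.forall_mem_cons.2 ⟨⟨by simp [hb], hvb⟩, S.mem⟩, ?_,
    S.sorted⟩
  · by_cases hzc : z = c
    · subst hzc
      simp [ha, hu', sortColour_eq_grey.2 ⟨hcb, List.mem_cons_of_mem v (.head _)⟩, hd.symm]
    by_cases hzv : z = v
    · subst hzv
      simp [hb, hv', sortColour_eq_grey.2 ⟨hvb, List.mem_cons_self⟩]
    · rw [hn z hzc hzv, S.shape.node z hz, List.map_cons]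
      have : sortColour bl (c :: ds.map Prod.snd) z = sortColour bl (v :: c :: ds.map Prod.snd) z :=
        sortColour_congr .rfl fun _ => by simp [hzv]
      simp [this, Ne.symm hzc, Ne.symm hzv]
  · rw [S.shape.split, ← Multiset.singleton_add]
    simp only [List.map_cons, ← Multiset.cons_coe, ← Multiset.singleton_add]
    abel
  · refine add_right_cancel (b := {e}) ?_
    rw [hE', add_right_comm, ← hE, S.shape.edges]
    simp only [List.map_cons, ← Multiset.cons_coe, ← Multiset.singleton_add]
    abel
  · intro z hz hzb hz'
    exact S.red z hz hzb fun h => hz' (.tail _ h)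

/-- Every edge of the list points one node closer to `c`. This is the return part of a detected
cycle. -/
theorem reaches (S : DashPath Into c ds) (he : ∀ e ∈ ds.map Prod.fst, e ∈ G.edges) {v : N}
    (hv : v ∈ c :: ds.map Prod.snd) : Relation.ReflTransGen G.Arc v c := by
  induction ds generalizing c with
  | nil =>
    obtain rfl := List.mem_singleton.1 hv
    exact .refl
  | cons d ds ih =>
    rcases List.mem_cons.1 hv with rfl | hv
    · exact .refl
    · exact (ih S.2 (fun e h => he e (.tail _ h)) hv).tail ⟨d.1, he _ (.head _), S.1.1, S.1.2⟩

/-- The root `c` has an arc to a grey node; grey nodes lie on the search path, from which `c` is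
reachable. Together this closes a cycle. -/
theorem not_isDAG (S : SortState G H p c U ds rl bl)
    (h : Derives [TopSort.loop, TopSort.twoCycle, TopSort.backEdge] H H') : ¬ G.IsDAG := by
  obtain ⟨u, v, e, x, y, r, hu, hv, he, hm, rfl, rfl⟩ := TopSort.derives_cycle h
  obtain ⟨-, -, -, hcu⟩ := S.shape.node_eq hu (by simp)
  obtain rfl : c = e.src := by simpa using hcu
  have hv := (sortColour_eq_grey.1 (S.shape.node_eq hv (by simp)).2.2.1).2
  have heG := S.shape.mem_of_mem_edges (S.shape.mem_unmarked he hm)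
  exact fun hd => hd e.src (.head' ⟨e, heG, rfl, rfl⟩
    (reaches S.path (fun e he => S.shape.mem_of_mem_dashed he) hv))

/-- The sources are the nodes behind `c`. On a simple path no dashed edge therefore leaves `c`. -/
theorem src_mem (S : DashPath Into c ds) (he : e ∈ ds.map Prod.fst) : e.src ∈ ds.map Prod.snd := by
  induction ds generalizing c with
  | nil => simp at he
  | cons d ds ih =>
    rcases List.mem_cons.1 he with rfl | he
    · rw [S.1.1]
      exact .head _
    · exact .tail _ (ih S.2 he)

/-- This is the edge along which the search left `v`. It is the dashed edge demanded by `two_cycle`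
and `back_edge` as local evidence that `v` is on the search path; `e.tgt ≠ v` serves the injectivity
of the match. -/
theorem exists_edge_of_mem (S : DashPath Into c ds) (hn : (c :: ds.map Prod.snd).Nodup) {v : N}
    (hv : v ∈ ds.map Prod.snd) :
    ∃ e ∈ ds.map Prod.fst, e.src = v ∧ e.tgt ≠ v ∧ e.tgt ∈ c :: ds.map Prod.snd := by
  induction ds generalizing c with
  | nil => simp at hv
  | cons d ds ih =>
    rcases List.mem_cons.1 hv with rfl | hv
    · refine ⟨d.1, .head _, S.1.1, ?_, by rw [S.1.2]; exact .head _⟩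
      rw [S.1.2]
      rintro rfl
      simp at hn
    · obtain ⟨e, he, h1, h2, h3⟩ := ih S.2 (List.nodup_cons.1 hn).2 hv
      exact ⟨e, .tail _ he, h1, h2, .tail _ h3⟩

/-- An edge leaving `c` is not dashed, so the colour of its target decides: a grey target triggers
one of the three cycle rules and a red one triggers `forward`. Only blue targets remain. -/
theorem closed (S : SortState G H p c U ds rl bl) (hf : ¬ ∃ H', Derives [TopSort.forward] H H')
    (hc : ¬ ∃ H', Derives [TopSort.loop, TopSort.twoCycle, TopSort.backEdge] H H') {v : N}
    (hv : G.Arc c v) : v ∈ bl := by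
  by_contra hvb
  obtain ⟨lc, hHc⟩ := S.node_root
  obtain ⟨e, he, rfl, rfl⟩ := hv
  have hGv := (G.edge_mem e he).2
  have hm := S.shape.unmarked e he
  rw [S.shape.split] at he
  rcases Multiset.mem_add.1 he with he | he
  swap
  · exact (List.nodup_cons.1 S.nodup).1 (src_mem S.path he)
  have he := S.shape.mem_edges.2 (.inl he)
  obtain ⟨s, t, a, m⟩ := e
  dsimp only at *
  subst hm
  by_cases hvc : t = s
  · subst hvc
    exact hc (TopSort.exists_loop hHc he)
  by_cases hvd : t ∈ ds.map Prod.snd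
  · obtain ⟨-, l, hl⟩ := S.node_path hvd
    obtain ⟨d, hd, hds, hdt, hdt'⟩ := exists_edge_of_mem S.path S.nodup hvd
    have hdm := S.shape.mem_edges.2 (.inr (.inl ⟨d, hd, rfl⟩))
    obtain ⟨ds, dt, da, dm⟩ := d
    dsimp only at *
    subst hds
    -- The successor of `t` on the search path is either `c` itself or a third node; injective
    -- matching again requires a rule for each case.
    rcases List.mem_cons.1 hdt' with rfl | hdt'
    · exact hc (TopSort.exists_twoCycle hl hHc hdm he)
    · obtain ⟨-, l', hl'⟩ := S.node_path hdt'
      exact hc (TopSort.exists_backEdge hl' hHc hl hdt he hdm)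
  · obtain ⟨l, hl⟩ := S.shape.exists_node (b := false) hGv (by simpa using Ne.symm hvc)
    rw [sortColour_eq_red.2 ⟨hvb, by simpa [hvc] using hvd⟩] at hl
    exact hf (TopSort.exists_forward hHc hl he)

/-- The common core of the two grey pushes, which end a search. The hypothesis `hc` is exactly the
new clause of `SortedList` for `c :: bl`. -/
theorem pushLast (S : SortState G H p c U [] rl bl) (hc : ∀ v, G.Arc c v → v ∈ bl) {x : Label}
    (hp : H'.node p = some ⟨TopSort.zero, .green, true⟩) (hx : H.node c = some ⟨x, .grey, true⟩)
    (hx' : H'.node c = some ⟨x, .blue, false⟩) (hn : ∀ w, w ≠ c → w ≠ p → H'.node w = H.node w)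
    (hE : H'.edges + pathEdges .blue p bl = H.edges + pathEdges .blue p (c :: bl)) :
    LoopState G H' p U rl (c :: bl) := by
  obtain ⟨hcp, ⟨a, ha, rfl⟩, -, -⟩ := S.shape.node_eq hx (by simp)
  obtain ⟨hcG, hcb⟩ := S.mem c (.head _)
  refine ⟨⟨S.shape.unmarked, S.shape.fresh, sortColour_ne_green _ _, hp, fun z hz => ?_,
    S.shape.split, ?_, S.shape.red_mem, List.forall_mem_cons.2 ⟨hcG, S.shape.blue_mem⟩,
    S.shape.red_nodup, List.nodup_cons.2 ⟨hcb, S.shape.blue_nodup⟩⟩, ?_, hc, S.sorted⟩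
  · by_cases hzc : z = c
    · subst hzc
      simp [ha, hx', sortColour_eq_blue.2 (List.mem_cons_self (a := z) (l := bl))]
    · rw [hn z hzc hz, S.shape.node z hz]
      have : sortColour bl (c :: ([] : List (Edge N × N)).map Prod.snd) z =
          sortColour (c :: bl) [] z :=
        sortColour_congr (by simp [hzc]) fun _ => by simp [hzc]
      rw [this]
      simp [Ne.symm hzc]
  · refine add_right_cancel (b := pathEdges .blue p bl) ?_
    rw [hE, S.shape.edges]
    simp only [List.map_nil]
    abel
  · intro v hv hvb
    rw [List.mem_cons, not_or] at hvb
    exact S.red v hv hvb.2 (by simpa using hvb.1)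

/-- The common core of the two back pushes: besides pushing `c`, they return the root to `u` and
turn `e` back into an unmarked edge. -/
theorem pushBack (S : SortState G H p c U ((e, u) :: ds) rl bl) (hc : ∀ v, G.Arc c v → v ∈ bl)
    {x y : Label} (hp : H'.node p = some ⟨TopSort.zero, .green, true⟩)
    (hy : H.node u = some ⟨y, .grey, false⟩) (hy' : H'.node u = some ⟨y, .grey, true⟩)
    (hx : H.node c = some ⟨x, .grey, true⟩) (hx' : H'.node c = some ⟨x, .blue, false⟩)
    (hn : ∀ w, w ≠ u → w ≠ c → w ≠ p → H'.node w = H.node w)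
    (hE : H'.edges + {e.dash} + pathEdges .blue p bl =
      H.edges + {e} + pathEdges .blue p (c :: bl)) :
    SortState G H' p u (U + {e}) ds rl (c :: bl) := by
  obtain ⟨hcp, ⟨a, ha, rfl⟩, -, -⟩ := S.shape.node_eq hx (by simp)
  obtain ⟨hup, ⟨b, hb, rfl⟩, -, -⟩ := S.shape.node_eq hy (by simp)
  obtain ⟨hcG, hcb⟩ := S.mem c (.head _)
  have hnd := List.nodup_cons.1 S.nodup
  refine ⟨⟨S.shape.unmarked, S.shape.fresh, sortColour_ne_green _ _, hp, fun z hz => ?_,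
    ?_, ?_, S.shape.red_mem, List.forall_mem_cons.2 ⟨hcG, S.shape.blue_mem⟩,
    S.shape.red_nodup, List.nodup_cons.2 ⟨hcb, S.shape.blue_nodup⟩⟩, S.path.2, hnd.2, ?_, ?_, hc,
    S.sorted⟩
  · by_cases hzc : z = c
    · subst hzc
      have huz : u ≠ z := fun h => hnd.1 (h ▸ .head _)
      simp [ha, hx', sortColour_eq_blue.2 (List.mem_cons_self (a := z) (l := bl)), huz]
    by_cases hzu : z = u
    · subst hzu
      have := (S.mem z (.tail _ (.head _))).2
      simp [hb, hy', sortColour_eq_grey.2 ⟨show z ∉ c :: bl by simp [hzc, this], List.mem_cons_self⟩]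
    · rw [hn z hzu hzc hz, S.shape.node z hz]
      have : sortColour bl (c :: ((e, u) :: ds).map Prod.snd) z =
          sortColour (c :: bl) (u :: ds.map Prod.snd) z :=
        sortColour_congr (by simp [hzc]) fun _ => by simp [hzc]
      rw [this]
      simp [Ne.symm hzc, Ne.symm hzu]
  · rw [S.shape.split]
    simp only [List.map_cons, ← Multiset.cons_coe, ← Multiset.singleton_add]
    abel
  · refine add_right_cancel (b := pathEdges .blue p bl) (add_right_cancel (b := {e.dash}) ?_)
    rw [add_right_comm, hE, S.shape.edges]
    simp only [List.map_cons, ← Multiset.cons_coe, ← Multiset.singleton_add]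
    abel
  · intro v hv
    refine ⟨(S.mem v (.tail _ hv)).1, fun hvb => ?_⟩
    rcases List.mem_cons.1 hvb with rfl | hvb
    · exact hnd.1 hv
    · exact (S.mem v (.tail _ hv)).2 hvb
  · intro v hv hvb hvd
    rw [List.mem_cons, not_or] at hvb
    exact S.red v hv hvb.2 fun h => (List.mem_cons.1 h).elim hvb.1 hvd

theorem of_greyFirstPush (S : SortState G H p c U [] rl bl) (hc : ∀ v, G.Arc c v → v ∈ bl)
    (h : Derives [TopSort.greyFirstPush] H H') : LoopState G H' p U rl (c :: bl) := by
  obtain ⟨q, u, x, hqu, hq, hu, hE, hq', hu', hn⟩ := TopSort.derives_greyFirstPush h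
  obtain ⟨rfl, hl⟩ := S.shape.eq_pointer hq
  obtain rfl : c = u := by simpa using (S.shape.node_eq hu (by simp)).2.2.2
  -- The empty pointer label leaves only `bl = []`.
  match bl, hl with
  | [], _ => exact S.pushLast hc hq' hu hu' (fun w h1 h2 => hn w h2 h1) (by simp [hE, pathEdges])

theorem of_greyPush (S : SortState G H p c U [] rl bl) (hc : ∀ v, G.Arc c v → v ∈ bl)
    (h : Derives [TopSort.greyPush] H H') : LoopState G H' p U rl (c :: bl) := by
  obtain ⟨u, v, q, x, M, hu, hq, hE, hE', hu', hn⟩ := TopSort.derives_greyPush h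
  obtain ⟨rfl, hl⟩ := S.shape.eq_pointer hq
  obtain ⟨hup, -, -, hcu⟩ := S.shape.node_eq hu (by simp)
  obtain rfl : c = u := by simpa using hcu
  obtain ⟨t, rfl⟩ := S.shape.blue_eq_cons (v := v) (by rw [hE]; simp)
  refine S.pushLast hc ((hn q hup.symm).trans hq) hu hu' (fun w h _ => hn w h) ?_
  rw [hE, hE']
  simp only [pathEdges]
  abel

theorem of_backFirstPush (S : SortState G H p c U ds rl bl) (hc : ∀ v, G.Arc c v → v ∈ bl)
    (h : Derives [TopSort.backFirstPush] H H') :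
    ∃ u U' ds', SortState G H' p u U' ds' rl (c :: bl) := by
  obtain ⟨u, v, q, x, y, e, M, -, hu, hv, hq, hes, het, hm, hE, hE', hu', hv', hq', hn⟩ :=
    TopSort.derives_backFirstPush h
  obtain ⟨rfl, hl⟩ := S.shape.eq_pointer hq
  obtain rfl : c = v := by simpa using (S.shape.node_eq hv (by simp)).2.2.2
  obtain ⟨ds, rfl⟩ := S.path.joins.eq_cons S.nodup (S.shape.mem_dashed (by rw [hE]; simp) hm)
    (.inl ⟨hes, het⟩)
  match bl, hl with
  | [], _ =>
    refine ⟨u, _, ds, S.pushBack hc hq' hu hu' hv hv' hn ?_⟩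
    rw [hE, hE']
    simp only [pathEdges]
    abel

theorem of_backPush (S : SortState G H p c U ds rl bl) (hc : ∀ v, G.Arc c v → v ∈ bl)
    (h : Derives [TopSort.backPush] H H') :
    ∃ u U' ds', SortState G H' p u U' ds' rl (c :: bl) := by
  obtain ⟨u, v, q, w, x, y, e, M, hnd, hu, hv, hq, hes, het, hm, hE, hE', hu', hv', hn⟩ :=
    TopSort.derives_backPush h
  obtain ⟨rfl, hl⟩ := S.shape.eq_pointer hq
  obtain rfl : c = v := by simpa using (S.shape.node_eq hv (by simp)).2.2.2
  obtain ⟨ds, rfl⟩ := S.path.joins.eq_cons S.nodup (S.shape.mem_dashed (by rw [hE]; simp) hm)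
    (.inl ⟨hes, het⟩)
  obtain ⟨t, rfl⟩ := S.shape.blue_eq_cons (v := w) (by rw [hE]; simp)
  have hq' : H'.node q = H.node q := hn q (by rintro rfl; simp at hnd) (by rintro rfl; simp at hnd)
  refine ⟨u, _, ds, S.pushBack hc (hq'.trans hq) hu hu' hv hv' (fun w h1 h2 _ => hn w h1 h2) ?_⟩
  rw [hE, hE']
  simp only [pathEdges]
  abel

/-- If the path had another node, a step back would be possible: by `back_first_push` when the blue
stack is empty and by `back_push` otherwise, the pointer label matching each case. -/
theorem path_eq_nil (S : SortState G H p c U ds rl bl)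
    (h1 : ¬ ∃ H', Derives [TopSort.backPush] H H')
    (h2 : ¬ ∃ H', Derives [TopSort.backFirstPush] H H') :
    ds = [] := by
  match ds, S with
  | [], _ => rfl
  | (e, u) :: ds, S =>
    obtain ⟨lc, hHc⟩ := S.node_root
    obtain ⟨-, l, hl⟩ := S.node_path (v := u) (.head _)
    have he := S.shape.mem_edges.2 (.inr (.inl ⟨e, .head _, rfl⟩))
    have hes := S.path.1.1
    have het := S.path.1.2
    obtain ⟨s, t, a, m⟩ := e
    dsimp only at hes het
    subst hes het
    match bl, S with
    | [], S => exact absurd (TopSort.exists_backFirstPush hl hHc S.shape.pointer he) h2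
    | w :: t, S =>
      obtain ⟨lw, hw⟩ := S.shape.exists_node (b := false) (S.shape.blue_mem w (.head _)) (by
        simp only [Bool.false_eq_true, Option.some.injEq, false_iff]
        rintro rfl
        exact (S.mem _ (.head _)).2 (.head _))
      rw [sortColour_eq_blue.2 (.head _)] at hw
      exact absurd (TopSort.exists_backPush hl hHc S.shape.pointer hw he
        (S.shape.mem_edges.2 (.inr (.inr (.inr (by simp [pathEdges])))))) h1

/-- A nonempty blue stack always admits `grey_push`, so its failure means that the stack is empty
and the pointer still unlabelled. -/
theorem exists_greyPush (S : SortState G H p c U ds rl bl)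
    (h : ¬ ∃ H', Derives [TopSort.greyPush] H H') : ∃ H', Derives [TopSort.greyFirstPush] H H' := by
  obtain ⟨lc, hHc⟩ := S.node_root
  match bl, S with
  | [], S => exact TopSort.exists_greyFirstPush S.shape.pointer hHc
  | w :: t, S =>
    obtain ⟨lw, hw⟩ := S.shape.exists_node (b := false) (S.shape.blue_mem w (.head _)) (by
      simp only [Bool.false_eq_true, Option.some.injEq, false_iff]
      rintro rfl
      exact (S.mem _ (.head _)).2 (.head _))
    rw [sortColour_eq_blue.2 (.head _)] at hw
    exact absurd (TopSort.exists_greyPush hHc hw S.shape.pointer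
      (S.shape.mem_edges.2 (.inr (.inr (.inr (by simp [pathEdges])))))) h

end SortState

end SearchStates

/-! ### Runs of the program -/

/-- A root is unmarked, and the input graph `G` has a directed cycle. -/
def Flagged (G H : HostGraph N) : Prop := (∃ H', Derives [TopSort.flag] H H') ∧ ¬ G.IsDAG

namespace TopSort

variable {G H : HostGraph N} {p : N} {B : HostGraph N → Prop} {F : Prop}

/-- Every completed iteration adds a blue node, which bounds the outer loop; the inner loop is
bounded by the growth of the search path. The loop is left by a break, either after a cycle is found
or after the start of the search has been pushed. -/
theorem spec_sortNodes {rl bl : List N} {c : N} {U : Multiset (Edge N)} {ds : List (Edge N × N)}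
    (S : SortState G H p c U ds rl bl) :
    Spec (.alap sortNodes) H
      (fun H => Flagged G H ∨ ∃ U bl, LoopState G H p U rl bl) B F := by
  let Inv : ℕ → HostGraph N → Prop := fun n H =>
    ∃ c U ds bl, SortState G H p c U ds rl bl ∧ n = G.finite_nodes.toFinset.card - bl.length
  refine Spec.alap Inv ?_ _ H ⟨c, U, ds, bl, S, rfl⟩
  clear S
  rintro n H ⟨c, U, ds, bl, S, rfl⟩
  let Inv' : ℕ → HostGraph N → Prop := fun n H =>
    ∃ c U ds, SortState G H p c U ds rl bl ∧ n = G.finite_nodes.toFinset.card - ds.length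
  refine .seq (.alap_call Inv' ?_ ⟨c, U, ds, S, rfl⟩) ?_
  · rintro n H H' ⟨c, U, ds, S, rfl⟩ h
    obtain ⟨v, e, U', S'⟩ := S.forward h
    refine ⟨_, ?_, v, U', _, S', rfl⟩
    have := S'.length_le
    simp only [List.length_cons] at this ⊢
    omega
  clear S
  -- The inner variant is dropped: the outer one depends only on `bl`, which `forward` leaves alone.
  rintro H ⟨⟨-, -, c, U, ds, S, -⟩, hf⟩
  refine .seq (R' := fun K => K = H ∧ ¬ ∃ H', Derives [loop, twoCycle, backEdge] H H')
    (.ift_call (fun H' h => ?_) fun h => ⟨rfl, h⟩) ?_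
  · refine .seq (R' := fun H => ∃ H', Derives [flag] H H')
      (.call (fun K hK => exists_derives_flag.2 (derives_setFlag hK)) fun hK => ?_)
      fun K hK => .brk (.inl ⟨hK, S.not_isDAG h⟩)
    obtain ⟨l, hl⟩ := S.node_root
    exact absurd (exists_setFlag hl) hK
  · rintro _ ⟨rfl, hc⟩
    have hc : ∀ v, G.Arc c v → v ∈ bl := fun v hv => S.closed hf hc hv
    have hlen := S.length_le
    refine .trye_call (fun H' h => ?_) fun h1 => .trye_call (fun H' h => ?_) fun h2 => ?_
    · obtain ⟨u, U', ds', S'⟩ := S.of_backPush hc h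
      refine ⟨_, ?_, u, U', ds', _, S', rfl⟩
      simp only [List.length_cons]
      omega
    · obtain ⟨u, U', ds', S'⟩ := S.of_backFirstPush hc h
      refine ⟨_, ?_, u, U', ds', _, S', rfl⟩
      simp only [List.length_cons]
      omega
    · obtain rfl := S.path_eq_nil h1 h2
      refine .seq (R' := fun H => ∃ U bl, LoopState G H p U rl bl)
        (.trye_call (fun H' h => ⟨U, _, S.of_greyPush hc h⟩) fun h3 =>
          .call (fun H' h => ⟨U, _, S.of_greyFirstPush hc h⟩) fun h => ?_)
        fun H' h => .brk (.inr h)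
      exact absurd (S.exists_greyPush h3) h

/-- Each iteration removes the top of the red stack. A flagged graph is admitted with any variant,
because the next iteration breaks immediately. -/
theorem spec_loopNodes {rl bl : List N} {U : Multiset (Edge N)} (S : LoopState G H p U rl bl) :
    Spec (.alap loopNodes) H
      (fun H => Flagged G H ∨ ∃ U bl, LoopState G H p U [] bl) B F := by
  let Inv : ℕ → HostGraph N → Prop := fun n H =>
    Flagged G H ∨ ∃ U rl bl, LoopState G H p U rl bl ∧ n = rl.length
  have hInv : ∀ {n u H'} {t : List N}, n = (u :: t).length →
      (Flagged G H' ∨ ∃ U bl, LoopState G H' p U t bl) → ∃ m < n, Inv m H' := by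
    rintro _ u H' t rfl h
    exact ⟨t.length, by simp, h.imp id fun ⟨U, bl, S⟩ => ⟨U, t, bl, S, rfl⟩⟩
  refine Spec.alap Inv ?_ _ H (.inr ⟨U, rl, bl, S, rfl⟩)
  clear S
  intro n H hH
  refine .seq (R' := fun K => K = H ∧ ¬ ∃ H', Derives [flag] H H')
    (.ift_call (fun H' h => .brk ?_) fun h => ⟨rfl, h⟩) ?_
  · refine .inl (hH.resolve_right ?_)
    rintro ⟨U, rl, bl, S, -⟩
    exact S.not_flag ⟨H', h⟩
  · rintro _ ⟨rfl, hf⟩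
    obtain ⟨U, rl, bl, S, hn⟩ := hH.resolve_left fun h => hf h.1
    refine .trye_call (fun H' h => ?_) fun h1 => .trye_call (fun H' h => ?_) fun h2 =>
      .tryte_call (fun H' h => ?_) fun h3 => .tryte_call (fun H' h => ?_) fun h4 => .brk ?_
    · obtain ⟨u, t, rfl, S'⟩ := S.of_skip1 h
      exact hInv hn (.inr ⟨_, _, S'⟩)
    · obtain ⟨u, rfl, S'⟩ := S.of_skip2 h1 h
      exact hInv hn (.inr ⟨_, _, S'⟩)
    · obtain ⟨u, t, rfl, S'⟩ := S.of_init1 h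
      -- The inner loop absorbs the breaks of its body, so seen from outside it neither breaks nor
      -- fails.
      exact (spec_sortNodes S' (B := fun _ => False) (F := False)).mono (fun _ => hInv hn)
        nofun nofun
    · obtain ⟨u, rfl, S'⟩ := S.of_init2 h3 h
      exact (spec_sortNodes S' (B := fun _ => False) (F := False)).mono (fun _ => hInv hn)
        nofun nofun
    · cases rl with
      | nil => exact .inr ⟨U, bl, S⟩
      | cons u t =>
        by_cases hu : u ∈ bl
        · exact absurd (S.exists_skip2 hu) h2
        · exact absurd (S.exists_init2 hu) h4

/-- The last test separates the two ways in which the second phase ends: a flag comes with a cycle,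
and without a flag the red stack has been exhausted. If `init` does not apply, the input is empty.
-/
theorem spec_main [Infinite N] (hG : G.IsInput) :
    Spec main G (fun H => (H = G ∧ ∀ v, G.node v = none) ∨
        (∃ v, G.node v ≠ none) ∧ ∃ p U bl, LoopState G H p U [] bl) B
      (¬ G.IsDAG) := by
  refine .tryt_call (fun H h => ?_) fun h => .inl ⟨rfl, fun v => ?_⟩
  · obtain ⟨p, c, S⟩ := hG.stackState h
    have hc : ∃ v, G.node v ≠ none := ⟨c, S.shape.red_mem c (.head _)⟩
    refine .seq (spec_stackNodes hG.connected ⟨p, c, _, _, _, S⟩) ?_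
    rintro H ⟨p, c, U, rl, S, hr⟩
    refine .seq (R' := fun H => LoopState G H p U rl []) (.call (fun H' h => S.unroot hr h) ?_) ?_
    · obtain ⟨l, hl⟩ := S.node_root
      exact fun h => absurd (exists_unroot hl) h
    · refine fun H S => .seq (spec_loopNodes S) fun H hH => .ift_call (fun H' h => .fail ?_)
        fun h => .inr ?_
      · rcases hH with hH | ⟨U, bl, S⟩
        · exact hH.2
        · exact absurd ⟨H', h⟩ S.not_flag
      · obtain ⟨U, bl, S⟩ := hH.resolve_left fun hH => h hH.1
        exact ⟨hc, p, U, bl, S⟩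
  · by_contra hv
    obtain ⟨⟨l, m, b⟩, ha⟩ := Option.ne_none_iff_exists'.1 hv
    obtain rfl := hG.grey v _ ha
    obtain rfl := hG.unrooted v _ ha
    exact h (exists_init ha)

end TopSort

/-! ### The resulting graphs -/

/-! ### Downward relations on lists and walks along paths -/

section SortedList

variable {A : N → N → Prop} {l : List N} {u v : N}

theorem SortedList.mono {A' : N → N → Prop} (h : SortedList A l)
    (hA : ∀ u ∈ l, ∀ v, A' u v → A u v) : SortedList A' l := by
  induction l with
  | nil => trivial
  | cons w l ih =>
    exact ⟨fun v hv => h.1 v (hA w (.head _) v hv), ih h.2 fun u hu => hA u (.tail _ hu)⟩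

theorem SortedList.mem (h : SortedList A l) (hu : u ∈ l) (huv : A u v) : v ∈ l := by
  induction l with
  | nil => simp at hu
  | cons w l ih =>
    rcases List.mem_cons.1 hu with rfl | hu
    · exact .tail _ (h.1 v huv)
    · exact .tail _ (ih h.2 hu)

/-- A cycle through the head would enter the tail, which is closed under `A` and does not contain
the head. For the other members, induction on the tail applies. -/
theorem SortedList.not_transGen (h : SortedList A l) (hl : l.Nodup) (hu : u ∈ l) :
    ¬ Relation.TransGen A u u := by
  induction l with
  | nil => simp at hu
  | cons w l ih =>
    have hl := List.nodup_cons.1 hl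
    rcases List.mem_cons.1 hu with rfl | hu
    · intro ht
      obtain ⟨v, huv, hvu⟩ := Relation.TransGen.head'_iff.1 ht
      have hv := h.1 v huv
      have key : ∀ w, Relation.ReflTransGen A v w → w ∈ l := by
        intro w hw
        induction hw with
        | refl => exact hv
        | tail _ hs ihv => exact h.2.mem ihv hs
      exact hl.1 (key _ hvu)
    · exact ih h.2 hl.2 hu

/-- A simple path is sorted by its own edges. Combined with `SortedList.not_transGen`, this yields
the antisymmetry of the resulting order. -/
theorem sortedList_pathEdges (m : EdgeMark) (hl : (u :: l).Nodup) :
    SortedList (fun v w => ∃ e ∈ pathEdges m u l, e.src = v ∧ e.tgt = w) (u :: l) := by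
  induction l generalizing u with
  | nil => exact ⟨fun v ⟨e, he, _⟩ => absurd he (Multiset.notMem_zero e), trivial⟩
  | cons w l ih =>
    have hl := List.nodup_cons.1 hl
    refine ⟨?_, (ih hl.2).mono ?_⟩
    · rintro v ⟨e, he, -, rfl⟩
      exact (mem_pathEdges he).2.2
    · rintro x hx y ⟨e, he, rfl, rfl⟩
      rcases Multiset.mem_add.1 he with he | he
      · obtain rfl := Multiset.mem_singleton.1 he
        exact absurd hx hl.1
      · exact ⟨e, he, rfl, rfl⟩

variable {R : N → N → Prop} {m : EdgeMark} {w : N}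

theorem reflTransGen_of_pathEdges (h : ∀ e ∈ pathEdges m u l, R e.src e.tgt) (hv : v ∈ u :: l) :
    Relation.ReflTransGen R u v := by
  induction l generalizing u with
  | nil =>
    obtain rfl := List.mem_singleton.1 hv
    exact .refl
  | cons w l ih =>
    rcases List.mem_cons.1 hv with rfl | hv
    · exact .refl
    · exact .head (h (plain m u w) (Multiset.mem_add.2 (.inl (Multiset.mem_singleton_self _))))
        (ih (fun e he => h e (Multiset.mem_add.2 (.inr he))) hv)

theorem reflTransGen_total_of_pathEdges (h : ∀ e ∈ pathEdges m u l, R e.src e.tgt)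
    (hv : v ∈ u :: l) (hw : w ∈ u :: l) :
    Relation.ReflTransGen R v w ∨ Relation.ReflTransGen R w v := by
  induction l generalizing u with
  | nil =>
    obtain rfl := List.mem_singleton.1 hv
    obtain rfl := List.mem_singleton.1 hw
    exact .inl .refl
  | cons x l ih =>
    rcases List.mem_cons.1 hv with rfl | hv'
    · exact .inl (reflTransGen_of_pathEdges h hw)
    rcases List.mem_cons.1 hw with rfl | hw'
    · exact .inr (reflTransGen_of_pathEdges h hv)
    · exact ih (fun e he => h e (Multiset.mem_add.2 (.inr he))) hv' hw'

/-- Related members lie further down the list, and the path runs down the list from `v`. -/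
theorem SortedList.reflTransGen (hA : SortedList A (u :: l))
    (h : ∀ e ∈ pathEdges m u l, R e.src e.tgt) (hv : v ∈ u :: l) (hvw : A v w) :
    Relation.ReflTransGen R v w := by
  induction l generalizing u with
  | nil =>
    obtain rfl := List.mem_singleton.1 hv
    exact absurd (hA.1 w hvw) List.not_mem_nil
  | cons x l ih =>
    rcases List.mem_cons.1 hv with rfl | hv'
    · exact reflTransGen_of_pathEdges h (.tail _ (hA.1 w hvw))
    · exact ih hA.2 (fun e he => h e (Multiset.mem_add.2 (.inr he))) hv'

end SortedList

/-! ### Properties of the final graph -/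

namespace LoopState

variable {G H : HostGraph N} {p : N} {U : Multiset (Edge N)} {bl : List N}

theorem mem_blue (S : LoopState G H p U [] bl) {v : N} (hv : G.node v ≠ none) : v ∈ bl := by
  by_contra h
  exact List.not_mem_nil (S.red v hv h)

/-- A node on a cycle would belong to the blue stack, whose arcs only lead downwards. So a cyclic
input cannot reach such a state. -/
theorem isDAG (S : LoopState G H p U [] bl) : G.IsDAG := by
  intro v hv
  obtain ⟨w, hvw, -⟩ := Relation.TransGen.head'_iff.1 hv
  exact S.sorted.not_transGen S.shape.blue_nodup (S.mem_blue hvw.mem.1) hv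

theorem edges_eq (S : LoopState G H p U [] bl) : H.edges = G.edges + pathEdges .blue p bl := by
  rw [S.shape.edges, S.shape.split]
  simp [pathEdges]

theorem isBlue_iff (S : LoopState G H p U [] bl) {v : N} : H.IsBlue v ↔ v ∈ bl := by
  constructor
  · rintro ⟨⟨l, m, b⟩, ha, hm⟩
    dsimp only at hm
    subst hm
    exact sortColour_eq_blue.1 (S.shape.node_eq ha (by simp)).2.2.1
  · intro hv
    obtain ⟨l, hl⟩ := S.shape.exists_node (b := false) (S.shape.blue_mem v hv) (by simp)
    exact ⟨_, hl, sortColour_eq_blue.2 hv⟩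

theorem mem_pathEdges_iff (S : LoopState G H p U [] bl) {e : Edge N} :
    e ∈ H.edges ∧ e.mark = .blue ↔ e ∈ pathEdges .blue p bl := by
  rw [S.edges_eq, Multiset.mem_add]
  constructor
  · rintro ⟨he | he, hm⟩
    · exact nomatch (S.shape.unmarked e he).symm.trans hm
    · exact he
  · exact fun he => ⟨.inr he, (mem_pathEdges he).1⟩

theorem mem_unmarked (S : LoopState G H p U [] bl) {e : Edge N} (he : e ∈ H.edges)
    (hm : e.mark = .unmarked) : e ∈ G.edges :=
  S.shape.mem_of_mem_edges (S.shape.mem_unmarked he hm)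

/-- A walk among all nodes is lifted to the subtype of blue nodes; for this, `R` must guarantee that
each source is blue. The equality built into `blueRel` turns the empty walk into a single step. -/
theorem transGen_blueRel {R : N → N → Prop}
    (hR : ∀ u v, R u v → H.IsBlue u ∧ ∃ e ∈ H.edges, e.mark = .blue ∧ e.src = u ∧ e.tgt = v)
    {u v : N} (h : Relation.ReflTransGen R u v) (hu : H.IsBlue u) (hv : H.IsBlue v) :
    Relation.TransGen H.blueRel ⟨u, hu⟩ ⟨v, hv⟩ := by
  induction h with
  | refl => exact .single (.inr rfl)
  | tail _ hs ih =>
    obtain ⟨hb, he⟩ := hR _ _ hs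
    exact .tail (ih hb) (.inl he)

theorem containsTopologicalSorting (S : LoopState G H p U [] bl) :
    H.ContainsTopologicalSorting := by
  let A : N → N → Prop := fun u v => ∃ e ∈ pathEdges .blue p bl, e.src = u ∧ e.tgt = v
  let R : N → N → Prop := fun u v => H.IsBlue u ∧ A u v
  have hR : ∀ u v, R u v →
      H.IsBlue u ∧ ∃ e ∈ H.edges, e.mark = .blue ∧ e.src = u ∧ e.tgt = v := by
    rintro u v ⟨hu, e, he, h⟩
    exact ⟨hu, e, (S.mem_pathEdges_iff.2 he).1, (S.mem_pathEdges_iff.2 he).2, h⟩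
  have hA : ∀ u v, Relation.TransGen H.blueRel u v → u = v ∨ Relation.TransGen A u.1 v.1 := by
    have key : ∀ u v, H.blueRel u v → u = v ∨ A u.1 v.1 := by
      rintro u v (⟨e, he, hm, h⟩ | rfl)
      · exact .inr ⟨e, S.mem_pathEdges_iff.1 ⟨he, hm⟩, h⟩
      · exact .inl rfl
    intro u v h
    induction h with
    | single h => exact (key _ _ h).imp id .single
    | tail _ h ih =>
      rcases key _ _ h with rfl | h
      · exact ih
      · rcases ih with rfl | ih
        · exact .inr (.single h)
        · exact .inr (ih.tail h)
  -- The edge from the pointer is left out, because the pointer is not blue.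
  have hpath : ∀ w t, bl = w :: t → ∀ e ∈ pathEdges .blue w t, R e.src e.tgt := by
    rintro w t rfl e he
    exact ⟨S.isBlue_iff.2 (mem_pathEdges he).2.1, e, Multiset.mem_add.2 (.inr he), rfl, rfl⟩
  refine ⟨fun u v huv hvu => ?_, fun _ _ _ => .trans, fun u v => ?_, fun u v => ?_⟩
  · by_contra hne
    -- Distinct nodes preceding each other would lie on a cycle of the simple path `p :: bl`.
    refine (sortedList_pathEdges .blue (List.nodup_cons.2
      ⟨S.shape.pointer_notMem_blue, S.shape.blue_nodup⟩)).not_transGen (List.nodup_cons.2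
      ⟨S.shape.pointer_notMem_blue, S.shape.blue_nodup⟩) (.tail _ (S.isBlue_iff.1 u.2)) ?_
    exact ((hA u v huv).resolve_left hne).trans ((hA v u hvu).resolve_left (Ne.symm hne))
  · have hu := S.isBlue_iff.1 u.2
    have hv := S.isBlue_iff.1 v.2
    cases hbl : bl with
    | nil => simp [hbl] at hu
    | cons w t =>
      rw [hbl] at hu hv
      exact (reflTransGen_total_of_pathEdges (hpath w t hbl) hu hv).imp
        (transGen_blueRel hR · _ _) (transGen_blueRel hR · _ _)
  · rintro ⟨e, he, hm, hs, ht⟩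
    have hu := S.isBlue_iff.1 u.2
    have hs := S.sorted
    cases hbl : bl with
    | nil => simp [hbl] at hu
    | cons w t =>
      rw [hbl] at hu hs
      exact transGen_blueRel hR (hs.reflTransGen (hpath w t hbl) hu
        ⟨e, S.mem_unmarked he hm, ‹_›, ht⟩) _ _

theorem isStacked (S : LoopState G H p U [] bl) (hG : G.IsInput) (h : ∃ v, G.node v ≠ none) :
    IsStacked G H := by
  obtain ⟨v, hv⟩ := h
  have hne : bl ≠ [] := List.ne_nil_of_mem (S.mem_blue hv)
  have hp : H.node p = some ⟨TopSort.zero, .green, true⟩ := by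
    rw [S.shape.pointer]
    cases bl with
    | nil => exact absurd rfl hne
    | cons w t => rfl
  refine ⟨p, bl, S.shape.fresh, hp, fun v hv => ?_,
    S.edges_eq.trans (congrArg _ (bluePath_eq_pathEdges p bl).symm), hne, S.shape.blue_nodup,
    fun v => S.isBlue_iff.symm, ⟨_, hp, rfl, rfl⟩, ?_, ?_⟩
  · rw [S.shape.node v hv]
    cases ha : G.node v with
    | none => rfl
    | some a =>
      have := hG.unrooted v a ha
      simp [sortColour_eq_blue.2 (S.mem_blue (v := v) (by simp [ha])), this]
  · rw [S.edges_eq, bluePath_eq_pathEdges, Multiset.filter_add,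
      Multiset.filter_eq_nil.2 fun e he => by simp [S.shape.unmarked e he],
      Multiset.filter_eq_self.2 fun e he => (mem_pathEdges he).1, zero_add]
  · intro e he hep
    rw [S.edges_eq, Multiset.mem_add] at he
    rcases he with he | he
    · rcases hep with rfl | rfl
      · exact absurd S.shape.fresh (G.edge_mem e he).1
      · exact absurd S.shape.fresh (G.edge_mem e he).2
    · exact (mem_pathEdges he).1

theorem isEquippedWithSorting (S : LoopState G H p U [] bl) (hG : G.IsInput)
    (h : ∃ v, G.node v ≠ none) : IsEquippedWithSorting G H :=
  ⟨S.containsTopologicalSorting, fun h' => absurd (h' h.choose) h.choose_spec, S.isStacked hG⟩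

end LoopState

theorem HostGraph.isDAG_of_empty {G : HostGraph N} (h : ∀ v, G.node v = none) : G.IsDAG := by
  intro v hv
  obtain ⟨w, hvw, -⟩ := Relation.TransGen.head'_iff.1 hv
  exact hvw.mem.1 (h v)

theorem HostGraph.isEquippedWithSorting_of_empty {G : HostGraph N} (h : ∀ v, G.node v = none) :
    IsEquippedWithSorting G G := by
  have : IsEmpty {v // G.IsBlue v} := ⟨fun ⟨v, a, ha, _⟩ => by simp [h v] at ha⟩
  exact ⟨⟨fun u => isEmptyElim u, fun u => isEmptyElim u, fun u => isEmptyElim u,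
    fun u => isEmptyElim u⟩, fun _ => rfl, fun ⟨v, hv⟩ => absurd (h v) hv⟩

end GP2

theorem mainTheorem1 {N : Type*} [Infinite N] (G : GP2.HostGraph N) (hG : G.IsInput) :
    GP2.Outcome.bot ∉ GP2.sem GP2.TopSort.main G ∧
    (¬ G.IsDAG → GP2.sem GP2.TopSort.main G = {GP2.Outcome.fail}) ∧
    (G.IsDAG →
      (GP2.sem GP2.TopSort.main G).Nonempty ∧
      ∀ o ∈ GP2.sem GP2.TopSort.main G,
        ∃ H, o = GP2.Outcome.graph H ∧ GP2.IsEquippedWithSorting G H) := by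
  have hS := GP2.TopSort.spec_main hG (B := fun _ => False)
  refine ⟨hS.bot_notMem_sem, fun hD => ?_, fun hD => ⟨hS.sem_nonempty, fun o ho => ?_⟩⟩
  -- Some outcome exists, and any result graph would certify that `G` is acyclic, so failure is the
  -- only outcome.
  · refine hS.sem_nonempty.subset_singleton_iff.1 fun o ho => ?_
    rcases hS.of_mem_sem ho with ⟨H, -, ⟨-, h⟩ | ⟨-, p, U, bl, S⟩⟩ | ⟨rfl, -⟩
    · exact absurd (GP2.HostGraph.isDAG_of_empty h) hD
    · exact absurd S.isDAG hD
    · rfl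
  · rcases hS.of_mem_sem ho with ⟨H, rfl, ⟨rfl, h⟩ | ⟨h, p, U, bl, S⟩⟩ | ⟨-, h⟩
    · exact ⟨H, rfl, GP2.HostGraph.isEquippedWithSorting_of_empty h⟩
    · exact ⟨H, rfl, S.isEquippedWithSorting hG h⟩
    · exact absurd hD h
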